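/- All Banach spaces are over a fixed field $\mathbb K\in\{\mathbb R,\mathbb C\}$; "subspace" means closed subspace, "quotient" means quotient by a closed subspace, and "isomorphic" means linearly homeomorphic. Let $1<p\le\infty$ and $1/p+1/q=1$ (so $q=1$ if $p=\infty$). For a Banach space $X$, $n\in\mathbb N$ and $c>0$, consider the following games of $n$ rounds. In round $i$ Player I chooses a weakly open neighbourhood $U_i$ of $0$ in $X$, and then Player II chooses $x_i\in U_i$ with $\|x_i\|\le1$. In the $A(c,p,n)$ game Player I wins if $\|\sum_{i=1}^n a_ix_i\|\le c$ for all $(a_i)\in\mathbb K^n$ with $\|(a_i)\|_{\ell_p^n}\le 1$; in the $N(c,p,n)$ game Player I wins if $\|\sum_{i=1}^n x_i\|\le c\,n^{1/p}$ (with $n^{1/\infty}=1$). Let $\mathsf a_{p,n}(X)$, resp. $\mathsf n_{p,n}(X)$, be the infimum (in $[0,\infty]$) of those $c>0$ for which Player I has a winning strategy in the $A(c,p,n)$ game, resp. the $N(c,p,n)$ game. $X$ has $\mathsf A_p$ if $\sup_n\mathsf a_{p,n}(X)<\infty$, and $X$ has $\mathsf N_p$ if $\sup_n\mathsf n_{p,n}(X)<\infty$.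 For $\tau\in(0,1)$ the Tsirelson norm on the space $c_{00}$ of finitely supported sequences $(x_k)_{k\ge1}$ is $\|x\|_{T_\tau}=\lim_l\|x\|_l$, where $\|x\|_0=\max_k|x_k|$ and $$\|x\|_{l+1}=\max\Bigl\{\|x\|_l,\ \tau\sup\Bigl\{\sum_{i=1}^n\|E_ix\|_l:\ n\in\mathbb N,\ n\le E_1<\dots<E_n\Bigr\}\Bigr\};$$ here the $E_i$ are finite subsets of $\mathbb N=\{1,2,\dots\}$, each lying to the left of the later ones, all of whose elements are at least $n$, and $E_ix$ is the restriction of $x$ to the coordinates in $E_i$. For $\theta\in(0,1)$, $T_{q,\theta}$ is the $q$-convexification of $T_{\theta^q}$, i.e. the completion of $c_{00}$ under the norm $\|x\|=\bigl\|(|x_k|^q)_k\bigr\|_{T_{\theta^q}}^{1/q}$, and $T_{q,\theta}^*$ is its dual. Theorem. Let $1<p\le\infty$ and $1/p+1/q=1$. (1) For every $\theta\in(0,1)$, $T_{q,\theta}^*$ is a separable infinite-dimensional Banach space with $\mathsf A_p$. (2) If $U$ is any Banach space with $\mathsf N_p$, then there is $\theta\in(0,1)$ such that $T_{q,\theta}^*$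 is not isomorphic to any subspace of any quotient of $U$. (3) Consequently neither class has a universal space, even up to subspaces of quotients: there is no Banach space $U$ with $\mathsf A_p$ such that every separable infinite-dimensional Banach space with $\mathsf A_p$ is isomorphic to a subspace of a quotient of $U$, and there is no Banach space $U$ with $\mathsf N_p$ such that every separable infinite-dimensional Banach space with $\mathsf N_p$ is isomorphic to a subspace of a quotient of $U$. -/

import Mathlib

open scoped ENNReal

universe u v

noncomputable section

/-! ### The two-player games and the classes `A_p`, `N_p` -/

section Games

variable (𝕜 : Type u) [RCLike 𝕜] (p : ℝ≥0∞) (X : Type v) [NormedAddCommGroup X] [NormedSpace 𝕜 X]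

/-- `W_X`: the weakly open neighbourhoods of `0` in `X`. -/
def WeakNhdZero : Type v :=
  {V : Set X // (0 : X) ∈ V ∧ IsOpen ((toWeakSpace 𝕜 X) '' V)}

/-- A strategy of Player I: to every finite sequence of earlier moves of Player II it assigns a
weakly open neighbourhood of `0`. (In a game of `n` rounds only its values at sequences of length
`< n` in the unit ball matter.) -/
def GameStrategy : Type v := (k : ℕ) → (Fin k → X) → WeakNhdZero 𝕜 X

variable {X}

/-- `(x_1, …, x_n)` in the closed unit ball is admissible for the strategy `χ` if every `x_j` lies
in the neighbourhood chosen by `χ` after the moves `x_1, …, x_{j-1}`. -/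
def GameStrategy.Admissible (χ : GameStrategy 𝕜 X) {n : ℕ} (x : Fin n → X) : Prop :=
  ∀ j : Fin n, ‖x j‖ ≤ 1 ∧ x j ∈ (χ j (fun i : Fin j => x ⟨i, i.isLt.trans j.isLt⟩)).1

variable (X)

/-- Player I has a winning strategy in the `A(c,p,n)` game on `X`. -/
def WinsA (c : ℝ) (n : ℕ) : Prop :=
  ∃ χ : GameStrategy 𝕜 X, ∀ x : Fin n → X, χ.Admissible 𝕜 x →
    ∀ a : PiLp p (fun _ : Fin n => 𝕜), ‖a‖ ≤ 1 → ‖∑ i, a i • x i‖ ≤ c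

/-- Player I has a winning strategy in the `N(c,p,n)` game on `X`; the exponent is `1/p`, which is
`0` for `p = ∞`. -/
def WinsN (c : ℝ) (n : ℕ) : Prop :=
  ∃ χ : GameStrategy 𝕜 X, ∀ x : Fin n → X, χ.Admissible 𝕜 x →
    ‖∑ i, x i‖ ≤ c * (n : ℝ) ^ (p⁻¹).toReal

/-- `a_{p,n}(X)`, the infimum (`∞` if there is none) of the `c > 0` for which Player I has a winning
strategy in the `A(c,p,n)` game. -/
def aConst (n : ℕ) : ℝ≥0∞ := ⨅ (c : ℝ) (_ : 0 < c) (_ : WinsA 𝕜 p X c n), ENNReal.ofReal c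

/-- `n_{p,n}(X)`, the infimum (`∞` if there is none) of the `c > 0` for which Player I has a winning
strategy in the `N(c,p,n)` game. -/
def nConst (n : ℕ) : ℝ≥0∞ := ⨅ (c : ℝ) (_ : 0 < c) (_ : WinsN 𝕜 p X c n), ENNReal.ofReal c

/-- The property `A_p`: `a_p(X) = sup_n a_{p,n}(X) < ∞`. -/
def HasA : Prop := (⨆ n : ℕ, aConst 𝕜 p X n) < ∞

/-- The property `N_p`: `n_p(X) = sup_n n_{p,n}(X) < ∞`. -/
def HasN : Prop := (⨆ n : ℕ, nConst 𝕜 p X n) < ∞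

end Games

/-- `X` is isomorphic (linearly homeomorphic) to a closed subspace of a quotient of `U` by a closed
subspace. -/
def IsoToSubspaceOfQuotient (𝕜 : Type*) [RCLike 𝕜] (X U : Type*)
    [NormedAddCommGroup X] [NormedSpace 𝕜 X] [NormedAddCommGroup U] [NormedSpace 𝕜 U] : Prop :=
  ∃ N : Submodule 𝕜 U, IsClosed (N : Set U) ∧
    ∃ Y : Submodule 𝕜 (U ⧸ N), IsClosed (Y : Set (U ⧸ N)) ∧ Nonempty (X ≃L[𝕜] Y)

/-! ### The Tsirelson norm on `c_00`

The coordinates of a sequence are labelled `0, 1, 2, …`; the coordinate with label `k` is the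
`(k+1)`-st one. -/

namespace Tsirelson

/-- `n ≤ E_1 < ⋯ < E_n` for finite sets of coordinates: all labels in the `E_i` are at least `n`
(with coordinates counted from `1`), and the sets are successive. -/
def Adm {n : ℕ} (E : Fin n → Finset ℕ) : Prop :=
  (∀ i, ∀ k ∈ E i, n ≤ k + 1) ∧ ∀ i j, i < j → ∀ k ∈ E i, ∀ m ∈ E j, k < m

/-- The restriction `E x` of `x` to the coordinates in `E`. -/
def restr (E : Finset ℕ) (x : ℕ →₀ ℝ) : ℕ →₀ ℝ := x.filter (fun k => k ∈ E)

/-- The increasing sequence of norms on `c_00` that defines the Tsirelson space `T_τ`. -/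
def normAux (τ : ℝ) : ℕ → (ℕ →₀ ℝ) → ℝ
  | 0, x => ⨆ k, |x k|
  | l + 1, x => max (normAux τ l x)
      (τ * sSup {s : ℝ | ∃ (n : ℕ) (E : Fin n → Finset ℕ), Adm E ∧
        s = ∑ i, normAux τ l (restr (E i) x)})

/-- The norm of the Tsirelson space `T_τ` on `c_00`. -/
def tnorm (τ : ℝ) (x : ℕ →₀ ℝ) : ℝ := ⨆ l, normAux τ l x

/-- The `ℓ_1` norm (auxiliary). -/
def l1 (x : ℕ →₀ ℝ) : ℝ := ∑ k ∈ x.support, |x k|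

lemma l1_eq {x : ℕ →₀ ℝ} {S : Finset ℕ} (h : x.support ⊆ S) : l1 x = ∑ k ∈ S, |x k| := by
  apply Finset.sum_subset h
  intro k _ hk
  simp [Finsupp.notMem_support_iff.mp hk]

lemma restr_apply (E : Finset ℕ) (x : ℕ →₀ ℝ) (k : ℕ) :
    restr E x k = if k ∈ E then x k else 0 := by
  simp [restr, Finsupp.filter_apply]

lemma sum_l1_restr_le {n : ℕ} {E : Fin n → Finset ℕ} (hE : Adm E) (x : ℕ →₀ ℝ) :
    ∑ i, l1 (restr (E i) x) ≤ l1 x := by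
  have h1 : ∀ i, l1 (restr (E i) x) = ∑ k ∈ x.support, |restr (E i) x k| := fun i =>
    l1_eq (by
      intro k hk
      rw [Finsupp.mem_support_iff, restr_apply] at hk
      rw [Finsupp.mem_support_iff]
      intro h
      simp [h] at hk)
  simp_rw [h1]
  rw [Finset.sum_comm]
  refine Finset.sum_le_sum fun k _ => ?_
  by_cases hk : ∃ i, k ∈ E i
  · obtain ⟨i, hi⟩ := hk
    rw [Finset.sum_eq_single i]
    · simp [restr_apply, hi]
    · intro j _ hj
      have : k ∉ E j := by
        intro hkj
        rcases lt_or_gt_of_ne hj with h | h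
        · exact lt_irrefl _ (hE.2 j i h k hkj k hi)
        · exact lt_irrefl _ (hE.2 i j h k hi k hkj)
      simp [restr_apply, this]
    · simp
  · push Not at hk
    simp [restr_apply, hk]

lemma bddAbove_abs (x : ℕ →₀ ℝ) : BddAbove (Set.range fun k => |x k|) := by
  refine ⟨l1 x, ?_⟩
  rintro _ ⟨k, rfl⟩
  by_cases hk : k ∈ x.support
  · exact Finset.single_le_sum (f := fun k => |x k|) (fun _ _ => abs_nonneg _) hk
  · simp only [Finsupp.notMem_support_iff.mp hk, abs_zero]
    exact Finset.sum_nonneg fun _ _ => abs_nonneg _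

lemma l1_nonneg (x : ℕ →₀ ℝ) : 0 ≤ l1 x := Finset.sum_nonneg fun _ _ => abs_nonneg _

variable {τ : ℝ}

lemma normAux_nonneg (τ : ℝ) (l : ℕ) (x : ℕ →₀ ℝ) : 0 ≤ normAux τ l x := by
  induction l with
  | zero => exact Real.iSup_nonneg fun _ => abs_nonneg _
  | succ l ih => exact le_max_of_le_left ih

/-- The sums over which the supremum in the definition of `normAux` is taken. -/
def sums (τ : ℝ) (l : ℕ) (x : ℕ →₀ ℝ) : Set ℝ :=
  {s : ℝ | ∃ (n : ℕ) (E : Fin n → Finset ℕ), Adm E ∧ s = ∑ i, normAux τ l (restr (E i) x)}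

lemma normAux_succ (τ : ℝ) (l : ℕ) (x : ℕ →₀ ℝ) :
    normAux τ (l + 1) x = max (normAux τ l x) (τ * sSup (sums τ l x)) := rfl

lemma sums_nonempty (τ : ℝ) (l : ℕ) (x : ℕ →₀ ℝ) : (sums τ l x).Nonempty :=
  ⟨0, 0, Fin.elim0, ⟨fun i => i.elim0, fun i => i.elim0⟩, by simp⟩

lemma normAux_le_l1 (h0 : 0 ≤ τ) (h1 : τ ≤ 1) (l : ℕ) (x : ℕ →₀ ℝ) : normAux τ l x ≤ l1 x := by
  induction l generalizing x with
  | zero =>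
    refine ciSup_le fun k => ?_
    by_cases hk : k ∈ x.support
    · exact Finset.single_le_sum (f := fun k => |x k|) (fun _ _ => abs_nonneg _) hk
    · simp only [Finsupp.notMem_support_iff.mp hk, abs_zero]
      exact l1_nonneg x
  | succ l ih =>
    refine max_le (ih x) ?_
    have h : sSup (sums τ l x) ≤ l1 x := by
      refine csSup_le (sums_nonempty τ l x) ?_
      rintro _ ⟨n, E, hE, rfl⟩
      exact (Finset.sum_le_sum fun i _ => ih _).trans (sum_l1_restr_le hE x)
    calc τ * sSup (sums τ l x) ≤ τ * l1 x := mul_le_mul_of_nonneg_left h h0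
      _ ≤ 1 * l1 x := mul_le_mul_of_nonneg_right h1 (l1_nonneg x)
      _ = l1 x := one_mul _

lemma sums_bddAbove (h0 : 0 ≤ τ) (h1 : τ ≤ 1) (l : ℕ) (x : ℕ →₀ ℝ) : BddAbove (sums τ l x) := by
  refine ⟨l1 x, ?_⟩
  rintro _ ⟨n, E, hE, rfl⟩
  exact (Finset.sum_le_sum fun i _ => normAux_le_l1 h0 h1 l _).trans (sum_l1_restr_le hE x)

lemma normAux_mono (h0 : 0 ≤ τ) (h1 : τ ≤ 1) (l : ℕ) {x y : ℕ →₀ ℝ} (h : ∀ k, |x k| ≤ |y k|) :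
    normAux τ l x ≤ normAux τ l y := by
  induction l generalizing x y with
  | zero => exact ciSup_mono (bddAbove_abs y) h
  | succ l ih =>
    refine max_le_max (ih h) (mul_le_mul_of_nonneg_left ?_ h0)
    refine csSup_le (sums_nonempty τ l x) ?_
    rintro _ ⟨n, E, hE, rfl⟩
    refine (Finset.sum_le_sum fun i _ => ih (y := restr (E i) y) fun k => ?_).trans
      (le_csSup (sums_bddAbove h0 h1 l y) ⟨n, E, hE, rfl⟩)
    rw [restr_apply, restr_apply]
    split_ifs
    · exact h k
    · simp

lemma normAux_add_le (h0 : 0 ≤ τ) (h1 : τ ≤ 1) (l : ℕ) (x y : ℕ →₀ ℝ) :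
    normAux τ l (x + y) ≤ normAux τ l x + normAux τ l y := by
  induction l generalizing x y with
  | zero =>
    refine ciSup_le fun k => (abs_add_le _ _).trans ?_
    exact add_le_add (le_ciSup (bddAbove_abs x) k) (le_ciSup (bddAbove_abs y) k)
  | succ l ih =>
    have h : sSup (sums τ l (x + y)) ≤ sSup (sums τ l x) + sSup (sums τ l y) := by
      refine csSup_le (sums_nonempty τ l _) ?_
      rintro _ ⟨n, E, hE, rfl⟩
      calc ∑ i, normAux τ l (restr (E i) (x + y))
          ≤ ∑ i, (normAux τ l (restr (E i) x) + normAux τ l (restr (E i) y)) :=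
            Finset.sum_le_sum fun i _ => by
              have : restr (E i) (x + y) = restr (E i) x + restr (E i) y := Finsupp.filter_add
              rw [this]
              exact ih _ _
        _ = _ := Finset.sum_add_distrib
        _ ≤ _ := add_le_add (le_csSup (sums_bddAbove h0 h1 l x) ⟨n, E, hE, rfl⟩)
            (le_csSup (sums_bddAbove h0 h1 l y) ⟨n, E, hE, rfl⟩)
    rw [normAux_succ, normAux_succ, normAux_succ]
    refine max_le ((ih x y).trans (add_le_add (le_max_left _ _) (le_max_left _ _))) ?_
    calc τ * sSup (sums τ l (x + y)) ≤ τ * (sSup (sums τ l x) + sSup (sums τ l y)) :=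
          mul_le_mul_of_nonneg_left h h0
      _ = τ * sSup (sums τ l x) + τ * sSup (sums τ l y) := mul_add _ _ _
      _ ≤ _ := add_le_add (le_max_right _ _) (le_max_right _ _)

lemma normAux_smul_le (h0 : 0 ≤ τ) (h1 : τ ≤ 1) (l : ℕ) {c : ℝ} (hc : 0 ≤ c) (x : ℕ →₀ ℝ) :
    normAux τ l (c • x) ≤ c * normAux τ l x := by
  induction l generalizing x with
  | zero =>
    refine ciSup_le fun k => ?_
    simp only [Finsupp.smul_apply, smul_eq_mul, abs_mul, abs_of_nonneg hc]
    exact mul_le_mul_of_nonneg_left (le_ciSup (bddAbove_abs x) k) hc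
  | succ l ih =>
    rw [normAux_succ, normAux_succ]
    have h : sSup (sums τ l (c • x)) ≤ c * sSup (sums τ l x) := by
      refine csSup_le (sums_nonempty τ l _) ?_
      rintro _ ⟨n, E, hE, rfl⟩
      calc ∑ i, normAux τ l (restr (E i) (c • x)) ≤ ∑ i, c * normAux τ l (restr (E i) x) :=
            Finset.sum_le_sum fun i _ => by
              have : restr (E i) (c • x) = c • restr (E i) x := by
                ext k
                simp [restr_apply]
              rw [this]
              exact ih _
        _ = c * ∑ i, normAux τ l (restr (E i) x) := (Finset.mul_sum _ _ _).symm
        _ ≤ _ := mul_le_mul_of_nonneg_left (le_csSup (sums_bddAbove h0 h1 l x) ⟨n, E, hE, rfl⟩) hc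
    refine max_le ((ih x).trans (mul_le_mul_of_nonneg_left (le_max_left _ _) hc)) ?_
    calc τ * sSup (sums τ l (c • x)) ≤ τ * (c * sSup (sums τ l x)) :=
          mul_le_mul_of_nonneg_left h h0
      _ = c * (τ * sSup (sums τ l x)) := by ring
      _ ≤ _ := mul_le_mul_of_nonneg_left (le_max_right _ _) hc

lemma bddAbove_normAux (h0 : 0 ≤ τ) (h1 : τ ≤ 1) (x : ℕ →₀ ℝ) :
    BddAbove (Set.range fun l => normAux τ l x) :=
  ⟨l1 x, by rintro _ ⟨l, rfl⟩; exact normAux_le_l1 h0 h1 l x⟩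

lemma tnorm_nonneg (τ : ℝ) (x : ℕ →₀ ℝ) : 0 ≤ tnorm τ x :=
  Real.iSup_nonneg fun l => normAux_nonneg τ l x

lemma abs_le_tnorm (h0 : 0 ≤ τ) (h1 : τ ≤ 1) (x : ℕ →₀ ℝ) (k : ℕ) : |x k| ≤ tnorm τ x :=
  (le_ciSup (bddAbove_abs x) k).trans (le_ciSup (bddAbove_normAux h0 h1 x) 0)

lemma tnorm_mono (h0 : 0 ≤ τ) (h1 : τ ≤ 1) {x y : ℕ →₀ ℝ} (h : ∀ k, |x k| ≤ |y k|) :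
    tnorm τ x ≤ tnorm τ y :=
  ciSup_mono (bddAbove_normAux h0 h1 y) fun l => normAux_mono h0 h1 l h

lemma tnorm_add_le (h0 : 0 ≤ τ) (h1 : τ ≤ 1) (x y : ℕ →₀ ℝ) :
    tnorm τ (x + y) ≤ tnorm τ x + tnorm τ y :=
  ciSup_le fun l => (normAux_add_le h0 h1 l x y).trans
    (add_le_add (le_ciSup (bddAbove_normAux h0 h1 x) l) (le_ciSup (bddAbove_normAux h0 h1 y) l))

lemma tnorm_smul_le (h0 : 0 ≤ τ) (h1 : τ ≤ 1) {c : ℝ} (hc : 0 ≤ c) (x : ℕ →₀ ℝ) :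
    tnorm τ (c • x) ≤ c * tnorm τ x :=
  ciSup_le fun l => (normAux_smul_le h0 h1 l hc x).trans
    (mul_le_mul_of_nonneg_left (le_ciSup (bddAbove_normAux h0 h1 x) l) hc)

lemma tnorm_smul (h0 : 0 ≤ τ) (h1 : τ ≤ 1) {c : ℝ} (hc : 0 < c) (x : ℕ →₀ ℝ) :
    tnorm τ (c • x) = c * tnorm τ x := by
  refine le_antisymm (tnorm_smul_le h0 h1 hc.le x) ?_
  have h := tnorm_smul_le h0 h1 (inv_nonneg.mpr hc.le) (c • x)
  rw [smul_smul, inv_mul_cancel₀ hc.ne', one_smul] at h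
  calc c * tnorm τ x ≤ c * (c⁻¹ * tnorm τ (c • x)) := mul_le_mul_of_nonneg_left h hc.le
    _ = tnorm τ (c • x) := by field_simp

lemma tnorm_zero (h0 : 0 ≤ τ) (h1 : τ ≤ 1) : tnorm τ 0 = 0 := by
  have h := tnorm_smul_le h0 h1 le_rfl (0 : ℕ →₀ ℝ)
  rw [zero_mul, smul_zero] at h
  exact le_antisymm h (tnorm_nonneg _ _)

/-! ### The `q`-convexification -/

variable {𝕜 : Type u} [RCLike 𝕜]

/-- The sequence `x^q = (|x_k|^q)_k`. -/
def absPow (q : Set.Ici (1 : ℝ)) (x : ℕ →₀ 𝕜) : ℕ →₀ ℝ :=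
  x.mapRange (fun a => ‖a‖ ^ (q : ℝ))
    (by simp [Real.zero_rpow (zero_lt_one.trans_le q.2).ne'])

/-- The norm `‖x‖ = ‖x^q‖_{T_{θ^q}}^{1/q}` of `T_{q,θ}` on `c_00`. -/
def qnorm (q : Set.Ici (1 : ℝ)) (θ : Set.Ioo (0 : ℝ) 1) (x : ℕ →₀ 𝕜) : ℝ :=
  tnorm ((θ : ℝ) ^ (q : ℝ)) (absPow q x) ^ (1 / (q : ℝ))

variable (q : Set.Ici (1 : ℝ)) (θ : Set.Ioo (0 : ℝ) 1)

lemma q_pos : (0 : ℝ) < q := zero_lt_one.trans_le q.2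

lemma par_nonneg : (0 : ℝ) ≤ (θ : ℝ) ^ (q : ℝ) := Real.rpow_nonneg θ.2.1.le _

lemma par_le_one : (θ : ℝ) ^ (q : ℝ) ≤ 1 :=
  Real.rpow_le_one θ.2.1.le θ.2.2.le (q_pos q).le

lemma absPow_apply (x : ℕ →₀ 𝕜) (k : ℕ) : absPow q x k = ‖x k‖ ^ (q : ℝ) := by
  simp [absPow]

lemma qnorm_nonneg (x : ℕ →₀ 𝕜) : 0 ≤ qnorm q θ x := Real.rpow_nonneg (tnorm_nonneg _ _) _

lemma qnorm_rpow (x : ℕ →₀ 𝕜) :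
    qnorm q θ x ^ (q : ℝ) = tnorm ((θ : ℝ) ^ (q : ℝ)) (absPow q x) := by
  rw [qnorm, ← Real.rpow_mul (tnorm_nonneg _ _), one_div, inv_mul_cancel₀ (q_pos q).ne',
    Real.rpow_one]

lemma norm_le_qnorm (x : ℕ →₀ 𝕜) (k : ℕ) : ‖x k‖ ≤ qnorm q θ x := by
  rw [← Real.rpow_le_rpow_iff (norm_nonneg _) (qnorm_nonneg q θ x) (q_pos q), qnorm_rpow,
    ← absPow_apply]
  exact (le_abs_self _).trans (abs_le_tnorm (par_nonneg q θ) (par_le_one q θ) _ _)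

lemma eq_zero_of_qnorm {x : ℕ →₀ 𝕜} (h : qnorm q θ x = 0) : x = 0 := by
  ext k
  have := norm_le_qnorm q θ x k
  rw [h] at this
  simpa using this

lemma qnorm_zero : qnorm q θ (0 : ℕ →₀ 𝕜) = 0 := by
  have h : absPow q (0 : ℕ →₀ 𝕜) = 0 := by
    ext k
    rw [absPow_apply]
    simp [Real.zero_rpow (q_pos q).ne']
  rw [qnorm, h, tnorm_zero (par_nonneg q θ) (par_le_one q θ)]
  exact Real.zero_rpow (one_div_pos.mpr (q_pos q)).ne'

lemma qnorm_smul (c : 𝕜) (x : ℕ →₀ 𝕜) : qnorm q θ (c • x) = ‖c‖ * qnorm q θ x := by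
  rcases eq_or_ne c 0 with rfl | hc
  · simp [qnorm_zero]
  have hc' : 0 < ‖c‖ := norm_pos_iff.mpr hc
  have h : absPow q (c • x) = (‖c‖ ^ (q : ℝ)) • absPow q x := by
    ext k
    simp only [absPow_apply, Finsupp.smul_apply, smul_eq_mul, norm_mul]
    exact Real.mul_rpow (norm_nonneg _) (norm_nonneg _)
  rw [qnorm, h, tnorm_smul (par_nonneg q θ) (par_le_one q θ) (Real.rpow_pos_of_pos hc' _),
    Real.mul_rpow (Real.rpow_nonneg hc'.le _) (tnorm_nonneg _ _), ← Real.rpow_mul hc'.le,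
    mul_one_div_cancel (q_pos q).ne', Real.rpow_one, qnorm]

lemma qnorm_add_le (x y : ℕ →₀ 𝕜) : qnorm q θ (x + y) ≤ qnorm q θ x + qnorm q θ y := by
  rcases (qnorm_nonneg q θ x).eq_or_lt with hx | hs
  · rw [eq_zero_of_qnorm q θ hx.symm, zero_add, qnorm_zero, zero_add]
  rcases (qnorm_nonneg q θ y).eq_or_lt with hy | ht
  · rw [eq_zero_of_qnorm q θ hy.symm, add_zero, qnorm_zero, add_zero]
  set s := qnorm q θ x with hs_def
  set t := qnorm q θ y with ht_def
  have hst : 0 < s + t := add_pos hs ht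
  have hq := q_pos q
  have h0 := par_nonneg q θ
  have h1 := par_le_one q θ
  set α : ℝ := (s + t) ^ (q : ℝ) * (s / (s + t)) / s ^ (q : ℝ) with hα
  set β : ℝ := (s + t) ^ (q : ℝ) * (t / (s + t)) / t ^ (q : ℝ) with hβ
  have hα0 : 0 ≤ α := by positivity
  have hβ0 : 0 ≤ β := by positivity
  have key : ∀ k, |absPow q (x + y) k| ≤ |(α • absPow q x + β • absPow q y) k| := by
    intro k
    have hn : (0 : ℝ) ≤ absPow q (x + y) k := by
      rw [absPow_apply]
      positivity
    rw [abs_of_nonneg hn]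
    refine le_trans ?_ (le_abs_self _)
    simp only [absPow_apply, Finsupp.add_apply, Finsupp.smul_apply, smul_eq_mul]
    have hx : ‖x k‖ / s ∈ Set.Ici (0 : ℝ) := Set.mem_Ici.mpr (by positivity)
    have hy : ‖y k‖ / t ∈ Set.Ici (0 : ℝ) := Set.mem_Ici.mpr (by positivity)
    have ha : 0 ≤ s / (s + t) := by positivity
    have hb : 0 ≤ t / (s + t) := by positivity
    have hab : s / (s + t) + t / (s + t) = 1 := by field_simp
    have hconv := (convexOn_rpow q.2).2 hx hy ha hb hab
    simp only [smul_eq_mul] at hconv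
    rw [Real.div_rpow (norm_nonneg _) hs.le, Real.div_rpow (norm_nonneg _) ht.le] at hconv
    calc ‖x k + y k‖ ^ (q : ℝ) ≤ (‖x k‖ + ‖y k‖) ^ (q : ℝ) :=
          Real.rpow_le_rpow (norm_nonneg _) (norm_add_le _ _) hq.le
      _ = ((s + t) * (s / (s + t) * (‖x k‖ / s) + t / (s + t) * (‖y k‖ / t))) ^ (q : ℝ) := by
          congr 1
          field_simp
      _ = (s + t) ^ (q : ℝ) *
            (s / (s + t) * (‖x k‖ / s) + t / (s + t) * (‖y k‖ / t)) ^ (q : ℝ) :=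
          Real.mul_rpow hst.le (by positivity)
      _ ≤ (s + t) ^ (q : ℝ) * (s / (s + t) * (‖x k‖ ^ (q : ℝ) / s ^ (q : ℝ)) +
            t / (s + t) * (‖y k‖ ^ (q : ℝ) / t ^ (q : ℝ))) :=
          mul_le_mul_of_nonneg_left hconv (by positivity)
      _ = α * ‖x k‖ ^ (q : ℝ) + β * ‖y k‖ ^ (q : ℝ) := by
          rw [hα, hβ]
          ring
  rw [← Real.rpow_le_rpow_iff (qnorm_nonneg q θ _) hst.le hq, qnorm_rpow]
  calc tnorm ((θ : ℝ) ^ (q : ℝ)) (absPow q (x + y))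
      ≤ tnorm ((θ : ℝ) ^ (q : ℝ)) (α • absPow q x + β • absPow q y) := tnorm_mono h0 h1 key
    _ ≤ α * tnorm ((θ : ℝ) ^ (q : ℝ)) (absPow q x) + β * tnorm ((θ : ℝ) ^ (q : ℝ)) (absPow q y) :=
        (tnorm_add_le h0 h1 _ _).trans
          (add_le_add (tnorm_smul_le h0 h1 hα0 _) (tnorm_smul_le h0 h1 hβ0 _))
    _ = α * s ^ (q : ℝ) + β * t ^ (q : ℝ) := by rw [← qnorm_rpow, ← qnorm_rpow]
    _ = (s + t) ^ (q : ℝ) := by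
        have hsq : s ^ (q : ℝ) ≠ 0 := (Real.rpow_pos_of_pos hs _).ne'
        have htq : t ^ (q : ℝ) ≠ 0 := (Real.rpow_pos_of_pos ht _).ne'
        rw [hα, hβ]
        field_simp

end Tsirelson

/-! ### The space `T_{q,θ}` and its dual -/

/-- `c_00` over `𝕜`, to be equipped with the norm of `T_{q,θ}`. -/
def TsirelsonPre (𝕜 : Type u) [RCLike 𝕜] (_q : Set.Ici (1 : ℝ)) (_θ : Set.Ioo (0 : ℝ) 1) : Type u :=
  ℕ →₀ 𝕜

section

variable (𝕜 : Type u) [RCLike 𝕜] (q : Set.Ici (1 : ℝ)) (θ : Set.Ioo (0 : ℝ) 1)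

instance : AddCommGroup (TsirelsonPre 𝕜 q θ) := inferInstanceAs (AddCommGroup (ℕ →₀ 𝕜))

instance : Module 𝕜 (TsirelsonPre 𝕜 q θ) := inferInstanceAs (Module 𝕜 (ℕ →₀ 𝕜))

instance : Norm (TsirelsonPre 𝕜 q θ) := ⟨fun x => Tsirelson.qnorm (𝕜 := 𝕜) q θ x⟩

lemma tsirelsonPre_core : NormedSpace.Core 𝕜 (TsirelsonPre 𝕜 q θ) where
  norm_nonneg x := Tsirelson.qnorm_nonneg (𝕜 := 𝕜) q θ x
  norm_smul c x := Tsirelson.qnorm_smul (𝕜 := 𝕜) q θ c x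
  norm_triangle x y := Tsirelson.qnorm_add_le (𝕜 := 𝕜) q θ x y
  norm_eq_zero_iff x :=
    ⟨fun h => Tsirelson.eq_zero_of_qnorm (𝕜 := 𝕜) q θ h,
      fun h => by rw [h]; exact Tsirelson.qnorm_zero (𝕜 := 𝕜) q θ⟩

instance : NormedAddCommGroup (TsirelsonPre 𝕜 q θ) :=
  NormedAddCommGroup.ofCore (tsirelsonPre_core 𝕜 q θ)

instance : NormedSpace 𝕜 (TsirelsonPre 𝕜 q θ) :=
  NormedSpace.ofCore (tsirelsonPre_core 𝕜 q θ)

/-- The Banach space `T_{q,θ}`: the `q`-convexification of the Tsirelson space `T_{θ^q}`, as the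
completion of `c_00`. -/
abbrev TsirelsonSpace : Type u := UniformSpace.Completion (TsirelsonPre 𝕜 q θ)

/-- The dual Banach space `T_{q,θ}^*`. -/
abbrev TsirelsonDual : Type u := StrongDual 𝕜 (TsirelsonSpace 𝕜 q θ)

end

end

/-! The proof sets the lower estimate built into the Tsirelson norm against the smallness of that
norm on repeated averages.

Property $\mathsf A_p$. The unit vector basis of $T_{q,\theta}$ is shrinking (`exists_tailBound`),
so Player I can force the moves in the dual to be, up to small errors, supported on successive
blocks lying beyond $n$. Such blocks are admissible, hence $T_{q,\theta}$ satisfies a lower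
$q$-estimate on them with constant $\theta$, and Hölder's inequality turns this into an upper
$p$-estimate with constant $\theta^{-1}$ in the dual (`Adm.sum_norm_mul_qnorm_le`, `winsA`). The
same estimate makes the coordinate functionals $e_k^*$ weakly null, and shrinking makes their span
dense.

Non-universality. Let $T_{q,\theta}^*$ embed into a quotient of $U$, where Player I wins every
$N(C,p,n)$ game on $U$. The images of the $e_k^*$ lift to bounded vectors in arbitrary weak
neighbourhoods of $0$ in $U$ (`exists_lift_small`), so Player II may play multiples of these
liftings. The sum of the moves against a winning strategy, divided by $Cn^{1/p}$, is again in the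
unit ball and weakly small, so the procedure can be iterated (`Reach.average`). After $2j$
iterations there is a vector of the unit ball of $U$ lifting the image of $c_0C^{-2j}\sum_k
x_k^{1/p}e_k^*$ with convex weights $x$. Two iterations multiply the bound on $\|x\|_{T_\tau}$,
$\tau=\theta^q$, by $2\tau$ (`Reach.tnorm_step`). Pairing with $\sum_k x_k^{1/q}e_k$ shows that
$\|\sum_k x_k^{1/p}e_k^*\|\ge(2\tau)^{-j/q}\ge(2\theta)^{-j}$ (`one_le_norm_powComb_mul`). The
embedding then forces $(2\theta C^2)^{-j}$ to be bounded in $j$, which fails for $\theta=1/(4C^2)$.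
-/

namespace Tsirelson

/-! ### Tsirelson norms of averages of successive vectors -/

/-- The sets `E i` are successive. -/
def Succ {ι : Type*} [LT ι] (E : ι → Finset ℕ) : Prop :=
  ∀ i j, i < j → ∀ k ∈ E i, ∀ m ∈ E j, k < m

variable {τ : ℝ}

lemma tnorm_le_l1 (h0 : 0 ≤ τ) (h1 : τ ≤ 1) (x : ℕ →₀ ℝ) : tnorm τ x ≤ l1 x :=
  ciSup_le fun l => normAux_le_l1 h0 h1 l x

/-- One half of the implicit equation for the Tsirelson norm. By induction on the level: the sums
defining level $l+1$ use level-$l$ norms, which the limit norm dominates. -/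
lemma tnorm_le_of_forall (h0 : 0 < τ) {x : ℕ →₀ ℝ} {B : ℝ} (hB : ∀ k, |x k| ≤ B)
    (h1 : τ ≤ 1)
    (h : ∀ (n : ℕ) (E : Fin n → Finset ℕ), Adm E → τ * ∑ i, tnorm τ (restr (E i) x) ≤ B) :
    tnorm τ x ≤ B := by
  refine ciSup_le fun l => ?_
  induction l with
  | zero => exact ciSup_le hB
  | succ l ih =>
    rw [normAux_succ]
    refine max_le ih ?_
    rw [← le_div_iff₀' h0]
    refine csSup_le (sums_nonempty τ l x) ?_
    rintro _ ⟨n, E, hE, rfl⟩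
    rw [le_div_iff₀' h0]
    refine le_trans ?_ (h n E hE)
    gcongr with i
    exact le_ciSup (bddAbove_normAux h0.le h1 _) l

lemma normAux_monotone (τ : ℝ) (x : ℕ →₀ ℝ) : Monotone fun l => normAux τ l x :=
  monotone_nat_of_le_succ fun _ => le_max_left _ _

lemma tendsto_normAux (h0 : 0 ≤ τ) (h1 : τ ≤ 1) (x : ℕ →₀ ℝ) :
    Filter.Tendsto (fun l => normAux τ l x) Filter.atTop (nhds (tnorm τ x)) :=
  tendsto_atTop_ciSup (normAux_monotone τ x) (bddAbove_normAux h0 h1 x)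

/-- The other half of the implicit equation, by letting the level tend to infinity in the finite
sum. -/
lemma Adm.mul_sum_tnorm_le (h0 : 0 ≤ τ) (h1 : τ ≤ 1) {n : ℕ} {E : Fin n → Finset ℕ} (hE : Adm E)
    (x : ℕ →₀ ℝ) : τ * ∑ i, tnorm τ (restr (E i) x) ≤ tnorm τ x := by
  refine le_of_tendsto' ((tendsto_finsetSum _
    fun i _ => tendsto_normAux h0 h1 (restr (E i) x)).const_mul τ) fun l => ?_
  refine le_trans ?_ (le_ciSup (bddAbove_normAux h0 h1 x) (l + 1))
  rw [normAux_succ]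
  exact le_max_of_le_right (mul_le_mul_of_nonneg_left
    (le_csSup (sums_bddAbove h0 h1 l x) ⟨n, E, hE, rfl⟩) h0)

lemma tnorm_restr_le (h0 : 0 ≤ τ) (h1 : τ ≤ 1) (E : Finset ℕ) (x : ℕ →₀ ℝ) :
    tnorm τ (restr E x) ≤ tnorm τ x := by
  refine tnorm_mono h0 h1 fun k => ?_
  rw [restr_apply]
  split_ifs <;> simp

lemma restr_add (E : Finset ℕ) (x y : ℕ →₀ ℝ) : restr E (x + y) = restr E x + restr E y :=
  Finsupp.filter_add

lemma restr_smul (E : Finset ℕ) (c : ℝ) (x : ℕ →₀ ℝ) : restr E (c • x) = c • restr E x :=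
  Finsupp.filter_smul

lemma restr_sum {ι : Type*} (s : Finset ι) (E : Finset ℕ) (x : ι → ℕ →₀ ℝ) :
    restr E (∑ i ∈ s, x i) = ∑ i ∈ s, restr E (x i) :=
  map_sum (Finsupp.filterAddHom (M := ℝ) fun k => k ∈ E) x s

lemma restr_eq_zero {E : Finset ℕ} {x : ℕ →₀ ℝ} (h : ∀ k ∈ E, k ∉ x.support) :
    restr E x = 0 := by
  ext k
  rw [restr_apply]
  split_ifs with hk
  · simpa using h k hk
  · rfl

lemma tnorm_sum_le (h0 : 0 ≤ τ) (h1 : τ ≤ 1) {ι : Type*} (s : Finset ι) (x : ι → ℕ →₀ ℝ) :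
    tnorm τ (∑ i ∈ s, x i) ≤ ∑ i ∈ s, tnorm τ (x i) :=
  Finset.le_sum_of_subadditive _ (tnorm_zero h0 h1).le (tnorm_add_le h0 h1) s x

/-- Only disjointness of the sets matters, so the bound is available for successive sets without any
condition on where they start. -/
lemma sum_l1_restr_le_of_succ {n : ℕ} {E : Fin n → Finset ℕ} (hE : Succ E) (x : ℕ →₀ ℝ) :
    ∑ i, l1 (restr (E i) x) ≤ l1 x := by
  have h1 : ∀ i, l1 (restr (E i) x) = ∑ k ∈ x.support, |restr (E i) x k| := fun i =>
    l1_eq (Finset.filter_subset _ _)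
  simp_rw [h1]
  rw [Finset.sum_comm]
  refine Finset.sum_le_sum fun k _ => ?_
  by_cases hk : ∃ i, k ∈ E i
  · obtain ⟨i, hi⟩ := hk
    rw [Finset.sum_eq_single i]
    · simp [restr_apply, hi]
    · intro j _ hj
      have : k ∉ E j := by
        intro hkj
        rcases lt_or_gt_of_ne hj with h | h
        · exact lt_irrefl _ (hE j i h k hkj k hi)
        · exact lt_irrefl _ (hE i j h k hi k hkj)
      simp [restr_apply, this]
    · simp
  · push Not at hk
    simp [restr_apply, hk]

lemma sum_tnorm_restr_le_l1 (h0 : 0 ≤ τ) (h1 : τ ≤ 1) {n : ℕ} {E : Fin n → Finset ℕ}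
    (hE : Succ E) (x : ℕ →₀ ℝ) : ∑ i, tnorm τ (restr (E i) x) ≤ l1 x :=
  (Finset.sum_le_sum fun _ _ => tnorm_le_l1 h0 h1 _).trans (sum_l1_restr_le_of_succ hE x)

/-- Among successive vectors at most `m` are split by `m` successive sets. -/
lemma sum_sum_tnorm_restr_le (h0 : 0 ≤ τ) (h1 : τ ≤ 1) {ι : Type*} [LinearOrder ι]
    (s : Finset ι) {m : ℕ} {x : ι → ℕ →₀ ℝ} (hx : Succ fun i => (x i).support)
    {E : Fin m → Finset ℕ} (hE : Succ E) {B b : ℝ} (hB0 : 0 ≤ B)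
    (hB : ∀ i ∈ s, ∑ j, tnorm τ (restr (E j) (x i)) ≤ B) (hb : ∀ i ∈ s, tnorm τ (x i) ≤ b) :
    ∑ i ∈ s, ∑ j, tnorm τ (restr (E j) (x i)) ≤ m * B + s.card * b := by
  classical
  set meets : ι → Fin m → Prop := fun i j => ∃ k ∈ E j, k ∈ (x i).support with hmeets
  set bad := s.filter fun i => ∃ j j', j < j' ∧ meets i j ∧ meets i j' with hbad
  have hzero : ∀ i j, ¬ meets i j → tnorm τ (restr (E j) (x i)) = 0 := fun i j h => by
    rw [restr_eq_zero, tnorm_zero h0 h1]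
    intro k hk hk'
    exact h ⟨k, hk, hk'⟩
  -- A split vector is sent to the smaller of two sets that it meets. This is injective: if a later
  -- split vector had the same image, the larger set of the earlier vector would have a point both
  -- to the left and to the right of a point of the common set.
  have hcard : bad.card ≤ m := by
    have hch : ∀ i ∈ bad, ∃ j j', j < j' ∧ meets i j ∧ meets i j' :=
      fun i hi => (Finset.mem_filter.mp hi).2
    choose g g' hlt hg hg' using hch
    have hne : ∀ i i' (hi : i ∈ bad) (hi' : i' ∈ bad), i < i' → g i hi ≠ g i' hi' := by
      intro i i' hi hi' hii heq
      obtain ⟨a, ha, ha'⟩ := hg' i hi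
      obtain ⟨c, hc, hc'⟩ := hg i' hi'
      have h1 := hx i i' hii a ha' c hc'
      have h2 := hE (g i hi) (g' i hi) (hlt i hi) c (heq ▸ hc) a ha
      omega
    rw [← Fintype.card_coe bad]
    refine (Fintype.card_le_of_injective (fun i : bad => g i.1 i.2) ?_).trans_eq
      (Fintype.card_fin m)
    intro i i' h
    rcases lt_trichotomy i.1 i'.1 with hl | hl | hl
    · exact absurd h (hne _ _ i.2 i'.2 hl)
    · exact Subtype.ext hl
    · exact absurd h.symm (hne _ _ i'.2 i.2 hl)
  have hle : ∀ i ∈ s, ∑ j, tnorm τ (restr (E j) (x i)) ≤ (if i ∈ bad then B else 0) + b := by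
    intro i hi
    have hb0 : 0 ≤ b := (tnorm_nonneg _ _).trans (hb i hi)
    split_ifs with h
    · linarith [hB i hi]
    rw [zero_add]
    by_cases hj : ∃ j, meets i j
    · obtain ⟨j, hj⟩ := hj
      rw [Finset.sum_eq_single j]
      · exact (tnorm_restr_le h0 h1 _ _).trans (hb i hi)
      · intro j' _ hne
        refine hzero i j' fun hm => h ?_
        rw [hbad, Finset.mem_filter]
        rcases lt_or_gt_of_ne hne with hl | hl
        · exact ⟨hi, j', j, hl, hm, hj⟩
        · exact ⟨hi, j, j', hl, hj, hm⟩
      · simp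
    · push Not at hj
      rw [Finset.sum_eq_zero fun j _ => hzero i j (hj j)]
      exact hb0
  refine (Finset.sum_le_sum hle).trans ?_
  rw [Finset.sum_add_distrib, Finset.sum_const, nsmul_eq_mul, ← Finset.sum_filter,
    Finset.sum_const, nsmul_eq_mul]
  have : (s.filter (· ∈ bad)).card ≤ m :=
    (Finset.card_le_card fun i hi => (Finset.mem_filter.mp hi).2).trans hcard
  gcongr

/-- `x` is bounded by `b` on any `m ≤ K` successive sets. -/
def SplitBound (τ : ℝ) (b : ℝ) (K : ℕ) (x : ℕ →₀ ℝ) : Prop :=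
  ∀ m ≤ K, ∀ E : Fin m → Finset ℕ, Succ E → ∑ j, tnorm τ (restr (E j) x) ≤ b

lemma sum_tnorm_restr_smul_sum_le (h0 : 0 ≤ τ) (h1 : τ ≤ 1) {ι : Type*} (s : Finset ι) {m : ℕ}
    (x : ι → ℕ →₀ ℝ) (E : Fin m → Finset ℕ) {c : ℝ} (hc : 0 ≤ c) :
    ∑ j, tnorm τ (restr (E j) (c • ∑ i ∈ s, x i)) ≤
      c * ∑ i ∈ s, ∑ j, tnorm τ (restr (E j) (x i)) := by
  rw [Finset.sum_comm, Finset.mul_sum]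
  refine Finset.sum_le_sum fun j _ => ?_
  rw [restr_smul, restr_sum]
  exact (tnorm_smul_le h0 h1 hc _).trans (mul_le_mul_of_nonneg_left (tnorm_sum_le h0 h1 _ _) hc)

/-- Averages of many successive vectors of small norm are hard to split. -/
lemma splitBound_average (h0 : 0 ≤ τ) (h1 : τ ≤ 1) {n K : ℕ} (hn : 0 < n) {x : Fin n → ℕ →₀ ℝ}
    (hx : Succ fun i => (x i).support) (hl : ∀ i, l1 (x i) ≤ 1) {b ε : ℝ}
    (hb : ∀ i, tnorm τ (x i) ≤ b) (hK : (K : ℝ) ≤ ε * n) :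
    SplitBound τ (ε + b) K ((n : ℝ)⁻¹ • ∑ i, x i) := by
  intro m hm E hE
  have hn' : (0 : ℝ) < n := by exact_mod_cast hn
  -- At most $m\le K\le\varepsilon n$ of the vectors are split, each costing no more than its
  -- $\ell_1$ norm; the others cost $b$ each.
  have key := sum_sum_tnorm_restr_le h0 h1 Finset.univ hx hE zero_le_one
    (fun i _ => (sum_tnorm_restr_le_l1 h0 h1 hE (x i)).trans (hl i)) (fun i _ => hb i)
  refine (sum_tnorm_restr_smul_sum_le h0 h1 _ x E (inv_nonneg.2 hn'.le)).trans ?_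
  rw [inv_mul_le_iff₀ hn']
  refine key.trans ?_
  have : (m : ℝ) ≤ K := by exact_mod_cast hm
  simp only [Finset.card_univ, Fintype.card_fin]
  linarith

lemma abs_le_l1 (x : ℕ →₀ ℝ) (k : ℕ) : |x k| ≤ l1 x := by
  by_cases hk : k ∈ x.support
  · exact Finset.single_le_sum (f := fun k => |x k|) (fun _ _ => abs_nonneg _) hk
  · simp only [Finsupp.notMem_support_iff.mp hk, abs_zero]
    exact l1_nonneg x

lemma abs_sum_le_one {ι : Type*} [LinearOrder ι] [Fintype ι] {x : ι → ℕ →₀ ℝ}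
    (hx : Succ fun i => (x i).support) (hl : ∀ i, l1 (x i) ≤ 1) (k : ℕ) :
    |(∑ i, x i) k| ≤ 1 := by
  rw [Finsupp.finsetSum_apply]
  by_cases hk : ∃ i, k ∈ (x i).support
  · obtain ⟨i, hi⟩ := hk
    rw [Finset.sum_eq_single i]
    · exact (abs_le_l1 _ _).trans (hl i)
    · intro j _ hj
      rw [← Finsupp.notMem_support_iff]
      intro hkj
      rcases lt_or_gt_of_ne hj with h | h
      · exact lt_irrefl _ (hx j i h k hkj k hi)
      · exact lt_irrefl _ (hx i j h k hi k hkj)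
    · simp
  · push Not at hk
    simp only [Finsupp.notMem_support_iff] at hk
    simp [hk]

lemma succ_of_mem_Ico {n : ℕ} {K : ℕ → ℕ} (hK : Monotone K) {x : Fin n → Finset ℕ}
    (hx : ∀ i, ∀ k ∈ x i, K i ≤ k ∧ k < K (i + 1)) : Succ x := by
  intro i j hij k hk m hm
  have h1 := (hx i k hk).2
  have h2 := (hx j m hm).1
  have h3 : K (i + 1) ≤ K j := hK hij
  omega

/-- This is where the factor $\tau$ is gained. Take $m$ admissible sets. If $m\le K_i$, the split
bound applies to $x_i$; if $K_{i+1}<m$, then $x_i$ lies to the left of all the sets and contributes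
nothing. At most one index has $K_i<m\le K_{i+1}$; its vector costs at most its $\ell_1$ norm,
whence the term $1/n$. -/
lemma tnorm_average_le (h0 : 0 < τ) (h1 : τ ≤ 1) {n : ℕ} (hn : 0 < n) {K : ℕ → ℕ}
    (hK : Monotone K) {x : Fin n → ℕ →₀ ℝ}
    (hx : ∀ i, ∀ k ∈ (x i).support, K i ≤ k ∧ k < K (i + 1)) (hl : ∀ i, l1 (x i) ≤ 1) {b : ℝ}
    (hb0 : 0 ≤ b) (hb : ∀ i : Fin n, SplitBound τ b (K i) (x i)) :
    tnorm τ ((n : ℝ)⁻¹ • ∑ i, x i) ≤ (n : ℝ)⁻¹ + τ * b := by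
  have hn' : (0 : ℝ) < n := by exact_mod_cast hn
  have hsucc : Succ fun i => (x i).support := succ_of_mem_Ico hK hx
  refine tnorm_le_of_forall h0 (fun k => ?_) h1 fun m E hE => ?_
  · rw [Finsupp.smul_apply, smul_eq_mul, abs_mul, abs_of_pos (inv_pos.2 hn')]
    have := mul_le_mul_of_nonneg_left (abs_sum_le_one hsucc hl k) (inv_nonneg.2 hn'.le)
    have := mul_nonneg h0.le hb0
    linarith
  set bad := Finset.univ.filter fun i : Fin n => K i < m ∧ m ≤ K (i + 1) with hbad
  have hcard : bad.card ≤ 1 := by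
    refine Finset.card_le_one.2 fun i hi j hj => ?_
    simp only [hbad, Finset.mem_filter, Finset.mem_univ, true_and] at hi hj
    by_contra hne
    rcases lt_or_gt_of_ne hne with h | h
    · have : K (i + 1) ≤ K j := hK h
      omega
    · have : K (j + 1) ≤ K i := hK h
      omega
  have hle : ∀ i, ∑ j, tnorm τ (restr (E j) (x i)) ≤ (if i ∈ bad then 1 else 0) + b := by
    intro i
    rcases le_or_gt m (K i) with h | h
    · have := hb i m h E hE.2
      split_ifs <;> linarith
    rcases le_or_gt m (K (i + 1)) with h' | h'
    · rw [if_pos (by simp [hbad, h, h'])]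
      linarith [(sum_tnorm_restr_le_l1 h0.le h1 hE.2 (x i)).trans (hl i)]
    · rw [Finset.sum_eq_zero]
      · split_ifs <;> linarith
      intro j _
      rw [restr_eq_zero, tnorm_zero h0.le h1]
      intro k hk hk'
      have := hE.1 j k hk
      have := (hx i k hk').2
      omega
  have hsum : ∑ i, ∑ j, tnorm τ (restr (E j) (x i)) ≤ 1 + n * b := by
    refine (Finset.sum_le_sum fun i _ => hle i).trans ?_
    rw [Finset.sum_add_distrib, ← Finset.sum_filter, Finset.sum_const, Finset.sum_const]
    simp only [nsmul_eq_mul, mul_one, Finset.card_univ, Fintype.card_fin]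
    have : ((Finset.univ.filter fun i => i ∈ bad).card : ℝ) ≤ 1 := by
      simpa using hcard
    linarith
  calc τ * ∑ j, tnorm τ (restr (E j) ((n : ℝ)⁻¹ • ∑ i, x i))
      ≤ τ * ((n : ℝ)⁻¹ * (1 + n * b)) := by
        gcongr
        exact (sum_tnorm_restr_smul_sum_le h0.le h1 _ x E (inv_nonneg.2 hn'.le)).trans
          (by gcongr)
    _ = τ * (n : ℝ)⁻¹ + τ * b := by field_simp
    _ ≤ _ := by
        have := mul_le_mul_of_nonneg_right h1 (inv_nonneg.2 hn'.le)
        linarith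

/-- A vector followed by an average of many successive vectors. -/
lemma tnorm_add_average_le (h0 : 0 < τ) (h1 : τ ≤ 1) {r m : ℕ} (hr : 0 < r) {y : ℕ →₀ ℝ}
    {x : Fin r → ℕ →₀ ℝ} (hx : Succ fun i => (x i).support) (hy : ∀ k ∈ y.support, k < m)
    (hxm : ∀ i, ∀ k ∈ (x i).support, m ≤ k)
    (hy1 : tnorm τ y ≤ 1) (hx1 : ∀ i, tnorm τ (x i) ≤ 1) :
    tnorm τ (y + (r : ℝ)⁻¹ • ∑ i, x i) ≤ 1 + τ + m / r := by
  have hr' : (0 : ℝ) < r := by exact_mod_cast hr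
  set z := (r : ℝ)⁻¹ • ∑ i, x i with hz
  have hz1 : tnorm τ z ≤ 1 := by
    refine (tnorm_smul_le h0.le h1 (inv_nonneg.2 hr'.le) _).trans ?_
    rw [inv_mul_le_iff₀ hr']
    refine (tnorm_sum_le h0.le h1 _ _).trans ((Finset.sum_le_sum fun i _ => hx1 i).trans ?_)
    simp
  have hzm : ∀ k < m, z k = 0 := by
    intro k hk
    rw [hz, Finsupp.smul_apply, Finsupp.finsetSum_apply, Finset.sum_eq_zero, smul_zero]
    intro i _
    rw [← Finsupp.notMem_support_iff]
    intro h
    exact absurd (hxm i k h) (by omega)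
  have hmr : (0 : ℝ) ≤ m / r := by positivity
  refine tnorm_le_of_forall h0 (fun k => ?_) h1 fun n E hE => ?_
  · rw [Finsupp.add_apply]
    rcases lt_or_ge k m with hk | hk
    · rw [hzm k hk, add_zero]
      linarith [abs_le_tnorm h0.le h1 y k]
    · have : y k = 0 := by
        rw [← Finsupp.notMem_support_iff]
        intro h
        exact absurd (hy k h) (by omega)
      rw [this, zero_add]
      linarith [abs_le_tnorm h0.le h1 z k]
  have hadd : τ * ∑ i, tnorm τ (restr (E i) (y + z)) ≤
      τ * ∑ i, tnorm τ (restr (E i) y) + τ * ∑ i, tnorm τ (restr (E i) z) := by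
    rw [← mul_add, ← Finset.sum_add_distrib]
    gcongr with i
    rw [restr_add]
    exact tnorm_add_le h0.le h1 _ _
  refine hadd.trans ?_
  -- With at most $m$ sets, at most $m$ of the $x_i$ are split, each costing $\tau^{-1}$, which
  -- gives $\tau+m/r$ for the average. With more than $m$ sets, admissibility places all of them
  -- beyond the support of $y$.
  rcases le_or_gt n m with hn | hn
  · have key := sum_sum_tnorm_restr_le h0.le h1 Finset.univ hx hE.2 (inv_nonneg.2 h0.le)
      (fun i _ => show _ ≤ τ⁻¹ by
        rw [← mul_one τ⁻¹, le_inv_mul_iff₀ h0]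
        exact (hE.mul_sum_tnorm_le h0.le h1 (x i)).trans (hx1 i)) (fun i _ => hx1 i)
    have h2 : τ * ∑ i, tnorm τ (restr (E i) z) ≤ τ + m / r := by
      calc τ * ∑ i, tnorm τ (restr (E i) z) ≤ τ * ((r : ℝ)⁻¹ * (m * τ⁻¹ + r)) := by
            gcongr
            refine (sum_tnorm_restr_smul_sum_le h0.le h1 _ x E (inv_nonneg.2 hr'.le)).trans ?_
            gcongr
            refine key.trans ?_
            simp only [Finset.card_univ, Fintype.card_fin, mul_one]
            gcongr
        _ = τ + m / r := by
            field_simp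
            ring
    linarith [(hE.mul_sum_tnorm_le h0.le h1 y).trans hy1]
  · rw [Finset.sum_eq_zero (f := fun i => tnorm τ (restr (E i) y))]
    · linarith [(hE.mul_sum_tnorm_le h0.le h1 z).trans hz1]
    intro i _
    rw [restr_eq_zero, tnorm_zero h0.le h1]
    intro k hk hk'
    have := hE.1 i k hk
    have := hy k hk'
    omega

end Tsirelson

/-! ### Weak neighbourhoods and liftings from quotients -/

section WeakTopology

open Filter Topology

variable {𝕜 : Type u} [RCLike 𝕜] {X : Type v} [NormedAddCommGroup X] [NormedSpace 𝕜 X]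

/-- A basic weak neighbourhood of `0`. -/
def weakNhdOfFinset (F : Finset (StrongDual 𝕜 X)) {η : ℝ} (hη : 0 < η) : WeakNhdZero 𝕜 X :=
  ⟨{x | ∀ f ∈ F, ‖f x‖ < η}, by simp [hη], by
    have : (toWeakSpace 𝕜 X) '' {x | ∀ f ∈ F, ‖f x‖ < η} =
        ⋂ f ∈ F, {w : WeakSpace 𝕜 X | ‖f ((toWeakSpace 𝕜 X).symm w)‖ < η} := by
      ext w
      simp only [Set.mem_image, Set.mem_ofPred_eq, Set.mem_iInter]
      constructor
      · rintro ⟨x, hx, rfl⟩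
        simpa using hx
      · intro h
        exact ⟨(toWeakSpace 𝕜 X).symm w, h, by simp⟩
    rw [this]
    refine isOpen_biInter_finset fun f _ => ?_
    exact isOpen_lt (WeakBilin.eval_continuous (topDualPairing 𝕜 X).flip f).norm continuous_const⟩

lemma mem_weakNhdOfFinset {F : Finset (StrongDual 𝕜 X)} {η : ℝ} (hη : 0 < η) {x : X} :
    x ∈ (weakNhdOfFinset F hη).1 ↔ ∀ f ∈ F, ‖f x‖ < η := Iff.rfl

lemma WeakNhdZero.exists_finset (V : WeakNhdZero 𝕜 X) :
    ∃ (F : Finset (StrongDual 𝕜 X)) (η : ℝ), 0 < η ∧ ∀ x, (∀ f ∈ F, ‖f x‖ < η) → x ∈ V.1 := by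
  have h0 : (toWeakSpace 𝕜 X) '' V.1 ∈ 𝓝 (0 : WeakSpace 𝕜 X) :=
    V.2.2.mem_nhds ⟨0, V.2.1, map_zero _⟩
  obtain ⟨S, hS, hSV⟩ :=
    ((LinearMap.hasBasis_weakBilin (topDualPairing 𝕜 X).flip).mem_iff (t := toWeakSpace 𝕜 X '' V.1)).1 h0
  rw [SeminormFamily.basisSets_iff] at hS
  obtain ⟨F, η, hη, rfl⟩ := hS
  refine ⟨F, η, hη, fun x hx => ?_⟩
  have : toWeakSpace 𝕜 X x ∈ toWeakSpace 𝕜 X '' V.1 := by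
    refine hSV ?_
    change x ∈ (F.sup (topDualPairing 𝕜 X).flip.toSeminormFamily).ball 0 η
    rw [Seminorm.mem_ball_zero]
    exact Seminorm.finset_sup_apply_lt hη fun f hf => hx f hf
  obtain ⟨y, hy, hyx⟩ := this
  rwa [← (toWeakSpace 𝕜 X).injective hyx]

/-- A functional that is small on a ball of a subspace is, up to a functional vanishing on that
subspace, small on the same ball of the whole space. -/
lemma exists_extension_le (N : Submodule 𝕜 X) (g : StrongDual 𝕜 X) {R s : ℝ} (hR : 0 < R)
    (hg : ∀ x ∈ N, ‖x‖ ≤ R → RCLike.re (g x) ≤ s) :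
    ∃ h : StrongDual 𝕜 X, (∀ x ∈ N, h x = g x) ∧ ∀ x, ‖x‖ ≤ R → ‖h x‖ ≤ s := by
  have hs : 0 ≤ s := by simpa using hg 0 N.zero_mem (by simpa using hR.le)
  -- Rotating $x$ by a unimodular scalar turns the bound on real parts into one on absolute values.
  have hg' : ∀ x ∈ N, ‖x‖ ≤ R → ‖g x‖ ≤ s := by
    intro x hx hxR
    obtain ⟨c, hc, hcx⟩ := RCLike.exists_norm_eq_mul_self (g x)
    have := hg (c • x) (N.smul_mem c hx) (by rw [norm_smul, hc, one_mul]; exact hxR)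
    rwa [map_smul, smul_eq_mul, ← hcx, RCLike.ofReal_re] at this
  obtain ⟨h, hh, hn⟩ := exists_extension_norm_eq N (g.comp N.subtypeL)
  refine ⟨h, fun x hx => by simpa using hh ⟨x, hx⟩, fun x hx => ?_⟩
  have hle : ‖h‖ ≤ s / R := by
    rw [hn]
    refine ContinuousLinearMap.opNorm_bound_of_ball_bound hR s _ fun z hz => ?_
    exact hg' z z.2 (by simpa using hz)
  refine (h.le_of_opNorm_le hle x).trans ?_
  calc s / R * ‖x‖ ≤ s / R * R := by gcongr
    _ = s := by field_simp

/-- Bounded liftings $x_j$ need not be weakly small, but their values $L(x_j)$ on the finitely many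
functionals subconverge to some $c$. It is enough that $c$ be a limit of values $L(z)$ with $z\in
N$, $\|z\|\le2$, because then $x_j-z$ lifts $y_j$ and is small. Otherwise a functional separating
$c$ from these values yields, after a correction, a functional on the quotient that contradicts weak
nullity. -/
lemma exists_lift_small (N : Submodule 𝕜 X) {y : ℕ → X ⧸ N}
    (hy : ∀ j, ‖y j‖ ≤ 1) (hw : ∀ g : StrongDual 𝕜 (X ⧸ N), Tendsto (fun j => g (y j)) atTop (𝓝 0))
    (F : Finset (StrongDual 𝕜 X)) {η : ℝ} (hη : 0 < η) (K : ℕ) :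
    ∃ j ≥ K, ∃ x : X, N.mkQ x = y j ∧ ‖x‖ ≤ 4 ∧ ∀ f ∈ F, ‖f x‖ < η := by
  have hlift : ∀ j, ∃ x : X, N.mkQ x = y j ∧ ‖x‖ ≤ 2 := by
    intro j
    obtain ⟨x, hx, hn⟩ := Submodule.Quotient.norm_mk_lt (y j) one_pos
    exact ⟨x, hx, by linarith [hy j]⟩
  choose x hx hx2 using hlift
  set L : X →L[𝕜] (F → 𝕜) := ContinuousLinearMap.pi fun f : F => f.1 with hL
  have hbdd : Bornology.IsBounded (Metric.closedBall (0 : F → 𝕜) (‖L‖ * 2)) :=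
    Metric.isBounded_closedBall
  obtain ⟨c, -, φ, hφ, hc⟩ := tendsto_subseq_of_bounded hbdd (x := fun j => L (x j)) fun j => by
    rw [mem_closedBall_zero_iff]
    exact L.le_opNorm_of_le (hx2 j)
  set S : Set (F → 𝕜) := L '' {z | z ∈ N ∧ ‖z‖ ≤ 2} with hS
  have hcS : c ∈ closure S := by
    by_contra hcS
    have hconv : Convex ℝ S := by
      rintro _ ⟨z, ⟨hz, hz2⟩, rfl⟩ _ ⟨w, ⟨hw, hw2⟩, rfl⟩ a b ha hb hab
      refine ⟨(a : 𝕜) • z + (b : 𝕜) • w,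
        ⟨N.add_mem (N.smul_mem _ hz) (N.smul_mem _ hw), ?_⟩, ?_⟩
      · refine (norm_add_le _ _).trans ?_
        rw [norm_smul, norm_smul, RCLike.norm_of_nonneg ha, RCLike.norm_of_nonneg hb]
        nlinarith
      · simp only [map_add, map_smul, RCLike.real_smul_eq_coe_smul (K := 𝕜)]
    obtain ⟨l, s, hl, hlc⟩ := RCLike.geometric_hahn_banach_closed_point (𝕜 := 𝕜) hconv.closure
      isClosed_closure hcS
    obtain ⟨h, hhN, hhs⟩ := exists_extension_le N (l.comp L) two_pos fun z hz hz2 =>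
      (hl _ (subset_closure ⟨z, ⟨hz, hz2⟩, rfl⟩)).le
    -- Subtracting $h$, which agrees with $l\circ L$ on $N$, makes the functional descend to the
    -- quotient. Since $g(y_j)\to0$ and $|h(x_j)|\le s$, the limit $\operatorname{Re}l(c)$ cannot
    -- exceed $s$.
    set g := N.liftQL (l.comp L - h) (fun z hz => sub_eq_zero.2 (hhN z hz).symm) with hg
    have hgx : ∀ j, g (y j) = l (L (x j)) - h (x j) := by
      intro j
      rw [← hx j]
      rfl
    have h1 : Tendsto (fun j => RCLike.re (l (L (x (φ j)))) - RCLike.re (g (y (φ j)))) atTop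
        (𝓝 (RCLike.re (l c) - RCLike.re (0 : 𝕜))) :=
      ((RCLike.continuous_re.tendsto _).comp ((l.continuous.tendsto _).comp hc)).sub
        ((RCLike.continuous_re.tendsto _).comp ((hw g).comp hφ.tendsto_atTop))
    have h2 : RCLike.re (l c) - RCLike.re (0 : 𝕜) ≤ s := by
      refine le_of_tendsto' h1 fun j => ?_
      rw [hgx, map_sub, sub_sub_cancel]
      exact (RCLike.re_le_norm _).trans (hhs _ (hx2 _))
    simp only [map_zero, sub_zero] at h2
    linarith
  obtain ⟨_, ⟨z, ⟨hzN, hz2⟩, rfl⟩, hz⟩ := Metric.mem_closure_iff.1 hcS (η / 2) (half_pos hη)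
  obtain ⟨j, hjK, hj⟩ := ((hφ.tendsto_atTop.eventually_ge_atTop K).and
    (Metric.tendsto_nhds.1 hc (η / 2) (half_pos hη))).exists
  refine ⟨φ j, hjK, x (φ j) - z, ?_, ?_, fun f hf => ?_⟩
  · rw [map_sub, hx, sub_eq_self]
    simpa using hzN
  · linarith [norm_sub_le (x (φ j)) z, hx2 (φ j)]
  · have h1 : ‖L (x (φ j) - z)‖ < η := by
      rw [map_sub, ← dist_eq_norm]
      have := dist_triangle_left (L (x (φ j))) (L z) c
      rw [dist_comm c (L (x (φ j)))] at this
      simp only [Function.comp] at hj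
      linarith
    exact (norm_le_pi_norm (L (x (φ j) - z)) ⟨f, hf⟩).trans_lt h1

end WeakTopology

/-! ### Convex weights and iterated play of the $N$ game -/

namespace Tsirelson

section Disjoint

lemma Succ.notMem {ι : Type*} [LinearOrder ι] {E : ι → Finset ℕ} (hE : Succ E) {i j : ι} (hij : i ≠ j) {k : ℕ}
    (hk : k ∈ E i) : k ∉ E j := by
  intro hkj
  rcases lt_or_gt_of_ne hij with h | h
  · exact lt_irrefl _ (hE i j h k hk k hkj)
  · exact lt_irrefl _ (hE j i h k hkj k hk)

variable {ι : Type*} [LinearOrder ι] [Fintype ι] {x : ι → ℕ →₀ ℝ}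

variable {ι : Type*} [LinearOrder ι] [Fintype ι] {x : ι → ℕ →₀ ℝ}

lemma sum_apply_of_mem_support (hx : Succ fun i => (x i).support) {i : ι} {k : ℕ}
    (hk : k ∈ (x i).support) : (∑ i, x i) k = x i k := by
  rw [Finsupp.finsetSum_apply]
  refine Finset.sum_eq_single i (fun j _ hj => ?_) (by simp)
  rw [← Finsupp.notMem_support_iff]
  exact hx.notMem hj.symm hk

lemma support_smul_sum (hx : Succ fun i => (x i).support) {c : ℝ} (hc : c ≠ 0) :
    (c • ∑ i, x i).support = Finset.univ.biUnion fun i => (x i).support := by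
  ext k
  rw [Finsupp.support_smul_eq hc, Finset.mem_biUnion]
  constructor
  · intro h
    by_contra! h'
    rw [Finsupp.mem_support_iff, Finsupp.finsetSum_apply] at h
    exact h (Finset.sum_eq_zero fun i hi => Finsupp.notMem_support_iff.1 (h' i hi))
  · rintro ⟨i, -, hi⟩
    rw [Finsupp.mem_support_iff, sum_apply_of_mem_support hx hi]
    exact Finsupp.mem_support_iff.1 hi

lemma sum_support_smul_sum {M : Type*} [AddCommMonoid M] (hx : Succ fun i => (x i).support)
    {c : ℝ} (hc : c ≠ 0) (f : ℕ → ℝ → M) :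
    ∑ k ∈ (c • ∑ i, x i).support, f k ((c • ∑ i, x i) k) =
      ∑ i, ∑ k ∈ (x i).support, f k (c * x i k) := by
  rw [support_smul_sum hx hc, Finset.sum_biUnion]
  · refine Finset.sum_congr rfl fun i _ => Finset.sum_congr rfl fun k hk => ?_
    rw [Finsupp.smul_apply, sum_apply_of_mem_support hx hk, smul_eq_mul]
  · intro i _ j _ hij
    exact Finset.disjoint_left.2 fun k hk => hx.notMem hij hk

lemma l1_average {n : ℕ} (hn : 0 < n) {x : Fin n → ℕ →₀ ℝ} (hx : Succ fun i => (x i).support)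
    (hl : ∀ i, l1 (x i) = 1) : l1 ((n : ℝ)⁻¹ • ∑ i, x i) = 1 := by
  have hn' : (0 : ℝ) < n := by exact_mod_cast hn
  rw [l1, sum_support_smul_sum hx (inv_ne_zero hn'.ne') fun _ a => |a|]
  simp_rw [abs_mul, ← Finset.mul_sum, abs_of_pos (inv_pos.2 hn')]
  have : ∀ i, ∑ k ∈ (x i).support, |x i k| = 1 := hl
  simp [this, hn'.ne']

end Disjoint

variable {𝕜 : Type u} [RCLike 𝕜] {Q : Type*} [AddCommGroup Q] [Module 𝕜 Q]

/-- The combination of the `z k` with coefficients `(x k) ^ s`. -/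
noncomputable def powComb (𝕜 : Type u) [RCLike 𝕜] {Q : Type*} [AddCommGroup Q] [Module 𝕜 Q] (s : ℝ) (z : ℕ → Q)
    (x : ℕ →₀ ℝ) : Q :=
  ∑ k ∈ x.support, ((x k ^ s : ℝ) : 𝕜) • z k

/-- Weights divided by $n$ have $s$-th powers divided by $n^s$. With $s=1/p$ this matches the
normalisation in the $N$ game, so averages of weights correspond to normalised sums of moves. -/
lemma powComb_average (s : ℝ) (z : ℕ → Q) {n : ℕ} (hn : 0 < n) {x : Fin n → ℕ →₀ ℝ}
    (hx : Succ fun i => (x i).support) (h0 : ∀ i k, 0 ≤ x i k) :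
    powComb 𝕜 s z ((n : ℝ)⁻¹ • ∑ i, x i) =
      ((((n : ℝ) ^ s)⁻¹ : ℝ) : 𝕜) • ∑ i, powComb 𝕜 s z (x i) := by
  have hn' : (0 : ℝ) < n := by exact_mod_cast hn
  rw [powComb, sum_support_smul_sum hx (inv_ne_zero hn'.ne') fun k a => ((a ^ s : ℝ) : 𝕜) • z k,
    Finset.smul_sum]
  refine Finset.sum_congr rfl fun i _ => ?_
  rw [powComb, Finset.smul_sum]
  refine Finset.sum_congr rfl fun k _ => ?_
  rw [Real.mul_rpow (inv_nonneg.2 hn'.le) (h0 i k), Real.inv_rpow hn'.le, smul_smul,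
    RCLike.ofReal_mul]

variable {U : Type v} [NormedAddCommGroup U] [NormedSpace 𝕜 U]

/-- In every weak neighbourhood of `0` in the unit ball of `U` there are liftings of the vectors
`c • ∑ (x k) ^ s • z k` for convex weights `x` with property `P` and support far out. -/
def Reach (π : U →ₗ[𝕜] Q) (z : ℕ → Q) (s c : ℝ) (P : ℕ → (ℕ →₀ ℝ) → Prop) : Prop :=
  ∀ (K : ℕ) (F : Finset (StrongDual 𝕜 U)) (η : ℝ), 0 < η → ∃ (y : U) (x : ℕ →₀ ℝ),
    (‖y‖ ≤ 1 ∧ (∀ f ∈ F, ‖f y‖ < η) ∧ π y = (c : 𝕜) • powComb 𝕜 s z x) ∧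
    (∀ k, 0 ≤ x k) ∧ l1 x = 1 ∧ (∀ k ∈ x.support, K ≤ k) ∧ P K x

variable {π : U →ₗ[𝕜] Q} {z : ℕ → Q} {s c : ℝ} {P P' : ℕ → (ℕ →₀ ℝ) → Prop}

/-- `Reach` supplies Player II with an answer to every move. Each answer is chosen beyond the
support of the previous one, in the neighbourhood of the strategy as well as in the one prescribed
by `F` and `η`. -/
lemma Reach.exists_play (hR : Reach π z s c P) (χ : GameStrategy 𝕜 U) (K₀ : ℕ)
    (F : Finset (StrongDual 𝕜 U)) {η : ℝ} (hη : 0 < η) (l : ℕ) :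
    ∃ (y : ℕ → U) (x : ℕ → ℕ →₀ ℝ) (K : ℕ → ℕ), Monotone K ∧ K 0 = K₀ ∧ ∀ i < l,
      (‖y i‖ ≤ 1 ∧ y i ∈ (χ i fun j : Fin i => y j).1 ∧ (∀ f ∈ F, ‖f (y i)‖ < η) ∧
        π (y i) = (c : 𝕜) • powComb 𝕜 s z (x i)) ∧
      (∀ k, 0 ≤ x i k) ∧ l1 (x i) = 1 ∧ (∀ k ∈ (x i).support, K i ≤ k ∧ k < K (i + 1)) ∧
      P (K i) (x i) := by
  classical
  induction l with
  | zero => exact ⟨0, 0, fun _ => K₀, monotone_const, rfl, fun i hi => absurd hi (by omega)⟩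
  | succ l ih =>
    obtain ⟨y, x, K, hK, hK0, h⟩ := ih
    obtain ⟨F', η', hη', hV⟩ := (χ l fun j : Fin l => y j).exists_finset
    obtain ⟨b, a, ⟨hb1, hbF, hπ⟩, ha0, hal, haK, haP⟩ :=
      hR (K l) (F ∪ F') (min η η') (lt_min hη hη')
    obtain ⟨K', hK', hle, hlt⟩ : ∃ K' : ℕ → ℕ, Monotone K' ∧ (∀ i ≤ l, K' i = K i) ∧
        K' (l + 1) = max (K l) (a.support.sup id + 1) := by
      refine ⟨fun i => if i ≤ l then K i else max (K l) (a.support.sup id + 1), ?_,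
        fun i hi => if_pos hi, if_neg (by omega)⟩
      intro i j hij
      dsimp only
      split_ifs with h1 h2 h2
      · exact hK hij
      · exact (hK h1).trans (le_max_left _ _)
      · omega
      · exact le_rfl
    obtain ⟨K', hK', hle, hlt⟩ : ∃ K' : ℕ → ℕ, Monotone K' ∧ (∀ i ≤ l, K' i = K i) ∧
        K' (l + 1) = max (K l) (a.support.sup id + 1) := by
      refine ⟨fun i => if i ≤ l then K i else max (K l) (a.support.sup id + 1), ?_,
        fun i hi => if_pos hi, if_neg (by omega)⟩
      intro i j hij
      dsimp only
      split_ifs with h1 h2 h2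
      · exact hK hij
      · exact (hK h1).trans (le_max_left _ _)
      · omega
      · exact le_rfl
    refine ⟨Function.update y l b, Function.update x l a, K', hK', by rw [hle 0 l.zero_le, hK0], ?_⟩
    intro i hi
    -- A change at position `l` leaves all histories of length at most `l` unchanged, so earlier
    -- moves stay admissible.
    have hhist : ∀ i ≤ l, (fun j : Fin i => Function.update y l b j) = fun j : Fin i => y j := by
      intro i hi
      funext j
      exact Function.update_of_ne (by have := j.2; omega) _ _
    rcases Nat.lt_succ_iff_lt_or_eq.1 hi with hi | rfl
    · rw [hhist i hi.le, Function.update_of_ne hi.ne, Function.update_of_ne hi.ne, hle i hi.le,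
        hle (i + 1) hi]
      exact h i hi
    · rw [hhist i le_rfl, Function.update_self, Function.update_self, hle i le_rfl, hlt]
      refine ⟨⟨hb1, hV b fun f hf => ?_, fun f hf => ?_, hπ⟩, ha0, hal, fun k hk => ⟨haK k hk, ?_⟩,
        haP⟩
      · exact (hbF f (Finset.mem_union_right _ hf)).trans_le (min_le_right _ _)
      · exact (hbF f (Finset.mem_union_left _ hf)).trans_le (min_le_left _ _)
      · have : k ≤ a.support.sup id := Finset.le_sup (f := id) hk
        exact lt_max_of_lt_right (by omega)

/-- The sum of $n$ answers to a winning strategy has norm at most $Cn^{1/p}$. Dividing by this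
number returns to the unit ball and averages the weights, at the price of one factor $C^{-1}$. The
number of rounds may depend on where the supports have to start. -/
lemma Reach.average {p : ℝ≥0∞} {C : ℝ} (hC : 1 ≤ C) (hN : ∀ n, WinsN 𝕜 p U C n)
    (hR : Reach π z (p⁻¹).toReal c P)
    (hP : ∀ K₀ : ℕ, ∃ n : ℕ, 0 < n ∧ ∀ (x : Fin n → ℕ →₀ ℝ) (K : ℕ → ℕ), Monotone K → K 0 = K₀ →
      (∀ i, l1 (x i) ≤ 1) → (∀ i, ∀ k ∈ (x i).support, K i ≤ k ∧ k < K (i + 1)) →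
      (∀ i : Fin n, P (K i) (x i)) → P' K₀ ((n : ℝ)⁻¹ • ∑ i, x i)) :
    Reach π z (p⁻¹).toReal (C⁻¹ * c) P' := by
  intro K₀ F η hη
  obtain ⟨n, hn, hP⟩ := hP K₀
  have hn' : (0 : ℝ) < n := by exact_mod_cast hn
  have hn1 : (1 : ℝ) ≤ n := by exact_mod_cast hn
  obtain ⟨χ, hχ⟩ := hN n
  -- The tolerance $\eta/n$ makes the sum of the moves $\eta$-small; dividing by $Cn^s\ge1$
  -- preserves this.
  obtain ⟨y, x, K, hK, hK0, h⟩ := hR.exists_play χ K₀ F (div_pos hη hn') n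
  set s := (p⁻¹).toReal with hs
  have hs0 : 0 ≤ s := ENNReal.toReal_nonneg
  have hns : 1 ≤ (n : ℝ) ^ s := Real.one_le_rpow hn1 hs0
  have hCn : 1 ≤ C * (n : ℝ) ^ s := one_le_mul_of_one_le_of_one_le hC hns
  have hCn0 : 0 < C * (n : ℝ) ^ s := one_pos.trans_le hCn
  have hsucc : Succ fun i : Fin n => (x i).support :=
    succ_of_mem_Ico hK fun i : Fin n => (h i i.2).2.2.2.1
  have hnorm : ‖∑ i : Fin n, y i‖ ≤ C * (n : ℝ) ^ s :=
    hχ (fun i => y i) fun i => ⟨(h i i.2).1.1, (h i i.2).1.2.1⟩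
  refine ⟨(((C * (n : ℝ) ^ s)⁻¹ : ℝ) : 𝕜) • ∑ i : Fin n, y i, (n : ℝ)⁻¹ • ∑ i : Fin n, x i,
    ⟨?_, fun f hf => ?_, ?_⟩, fun k => ?_, l1_average hn hsucc fun i => (h i i.2).2.2.1,
    fun k hk => ?_, ?_⟩
  · rw [norm_smul, RCLike.norm_of_nonneg (inv_nonneg.2 hCn0.le), inv_mul_le_iff₀ hCn0, mul_one]
    exact hnorm
  · rw [map_smul, norm_smul, RCLike.norm_of_nonneg (inv_nonneg.2 hCn0.le), inv_mul_lt_iff₀ hCn0,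
      map_sum]
    calc ‖∑ i : Fin n, f (y i)‖ ≤ ∑ i : Fin n, ‖f (y i)‖ := norm_sum_le _ _
      _ < ∑ i : Fin n, η / n := Finset.sum_lt_sum_of_nonempty ⟨⟨0, hn⟩, Finset.mem_univ _⟩
          fun i _ => (h i i.2).1.2.2.1 f hf
      _ = η := by
          rw [Finset.sum_const, Finset.card_univ, Fintype.card_fin, nsmul_eq_mul]
          field_simp
      _ ≤ C * (n : ℝ) ^ s * η := le_mul_of_one_le_left hη.le hCn
  · rw [powComb_average s z hn hsucc fun i => (h i i.2).2.1, map_smul, map_sum,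
      Finset.sum_congr rfl fun (i : Fin n) _ => (h i i.2).1.2.2.2, ← Finset.smul_sum, smul_smul, smul_smul,
      ← RCLike.ofReal_mul, ← RCLike.ofReal_mul]
    congr 2
    rw [mul_inv]
    ring
  · rw [Finsupp.smul_apply, Finsupp.finsetSum_apply, smul_eq_mul]
    exact mul_nonneg (inv_nonneg.2 hn'.le) (Finset.sum_nonneg fun i _ => (h i i.2).2.1 k)
  · rw [support_smul_sum hsucc (inv_ne_zero hn'.ne'), Finset.mem_biUnion] at hk
    obtain ⟨i, -, hi⟩ := hk
    rw [← hK0]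
    exact (hK (Nat.zero_le _)).trans ((h i i.2).2.2.2.1 k hi).1
  · exact hP (fun i => x i) K hK hK0 (fun i => (h i i.2).2.2.1.le) (fun i => (h i i.2).2.2.2.1)
      fun i => (h i i.2).2.2.2.2

/-- Two successive averages gain a factor of the order of `τ` in the Tsirelson norm. -/
lemma Reach.tnorm_step {p : ℝ≥0∞} {C : ℝ} (hC : 1 ≤ C) (hN : ∀ n, WinsN 𝕜 p U C n) {τ : ℝ}
    (h0 : 0 < τ) (h1 : τ ≤ 1) {b : ℝ} (hb : 0 < b)
    (hR : Reach π z (p⁻¹).toReal c fun _ x => tnorm τ x ≤ b) :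
    Reach π z (p⁻¹).toReal (C⁻¹ * (C⁻¹ * c)) fun _ x => tnorm τ x ≤ 2 * τ * b := by
  -- The first average leaves the norm bound essentially unchanged but makes the weights hard to
  -- split by few sets, namely by at most as many as the start of the support allows.
  have hA : Reach π z (p⁻¹).toReal (C⁻¹ * c) (SplitBound τ (b / 2 + b)) := by
    refine hR.average hC hN fun K₀ => ?_
    obtain ⟨n, hn⟩ := exists_nat_gt (K₀ / (b / 2))
    have hb2 : 0 < b / 2 := half_pos hb
    refine ⟨n, ?_, fun x K hK hK0 hl hx hP => ?_⟩
    · have : (0 : ℝ) < n := (div_nonneg (Nat.cast_nonneg _) hb2.le).trans_lt hn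
      exact_mod_cast this
    · refine splitBound_average h0.le h1 ?_ (succ_of_mem_Ico hK hx) hl hP ?_
      · have : (0 : ℝ) < n := (div_nonneg (Nat.cast_nonneg _) hb2.le).trans_lt hn
        exact_mod_cast this
      · rw [div_lt_iff₀ hb2] at hn
        linarith
  -- The second average gains $\tau$: with $1/n\le\tau b/2$ the bound is $\tau
  -- b/2+\tau\cdot\tfrac32b=2\tau b$.
  refine hA.average hC hN fun K₀ => ?_
  have hτb : 0 < τ * b / 2 := by positivity
  obtain ⟨n, hn⟩ := exists_nat_gt (τ * b / 2)⁻¹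
  have hn' : (0 : ℝ) < n := (inv_pos.2 hτb).trans hn
  have hn0 : 0 < n := by exact_mod_cast hn'
  refine ⟨n, hn0, fun x K hK _ hl hx hP => ?_⟩
  refine (tnorm_average_le h0 h1 hn0 hK hx hl (by positivity) hP).trans ?_
  have := (inv_lt_of_inv_lt₀ hτb hn).le
  linarith

lemma Reach.tnorm_iterate {p : ℝ≥0∞} {C : ℝ} (hC : 1 ≤ C) (hN : ∀ n, WinsN 𝕜 p U C n) {τ : ℝ}
    (h0 : 0 < τ) (h1 : τ ≤ 1) (hR : Reach π z (p⁻¹).toReal c fun _ x => tnorm τ x ≤ 1) (j : ℕ) :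
    Reach π z (p⁻¹).toReal ((C⁻¹ * C⁻¹) ^ j * c) fun _ x => tnorm τ x ≤ (2 * τ) ^ j := by
  induction j with
  | zero => simpa using hR
  | succ j ih =>
    have := ih.tnorm_step hC hN h0 h1 (by positivity)
    rwa [← mul_assoc, ← mul_assoc, ← pow_succ', ← pow_succ'] at this

end Tsirelson

/-! ### The space $T_{q,\theta}$ and its shrinking basis -/

namespace Tsirelson

variable {𝕜 : Type u} [RCLike 𝕜] (q : Set.Ici (1 : ℝ)) (θ : Set.Ioo (0 : ℝ) 1)

lemma par_pos : (0 : ℝ) < (θ : ℝ) ^ (q : ℝ) := Real.rpow_pos_of_pos θ.2.1 _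

lemma par_lt_one : (θ : ℝ) ^ (q : ℝ) < 1 := Real.rpow_lt_one θ.2.1.le θ.2.2 (q_pos q)

lemma absPow_nonneg (x : ℕ →₀ 𝕜) (k : ℕ) : 0 ≤ absPow q x k := by
  rw [absPow_apply]
  exact Real.rpow_nonneg (norm_nonneg _) _

lemma support_absPow (x : ℕ →₀ 𝕜) : (absPow q x).support = x.support := by
  ext k
  rw [Finsupp.mem_support_iff, Finsupp.mem_support_iff, absPow_apply, Ne,
    Real.rpow_eq_zero (norm_nonneg _) (q_pos q).ne', norm_eq_zero]

lemma absPow_filter (E : Finset ℕ) (x : ℕ →₀ 𝕜) :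
    absPow q (x.filter (· ∈ E)) = restr E (absPow q x) := by
  ext k
  rw [absPow_apply, restr_apply, absPow_apply, Finsupp.filter_apply]
  split_ifs
  · rfl
  · rw [norm_zero, Real.zero_rpow (q_pos q).ne']

lemma qnorm_mono {x y : ℕ →₀ 𝕜} (h : ∀ k, ‖x k‖ ≤ ‖y k‖) : qnorm q θ x ≤ qnorm q θ y := by
  refine Real.rpow_le_rpow (tnorm_nonneg _ _) ?_ (one_div_nonneg.2 (q_pos q).le)
  refine tnorm_mono (par_nonneg q θ) (par_le_one q θ) fun k => ?_
  rw [abs_of_nonneg (absPow_nonneg q x k), abs_of_nonneg (absPow_nonneg q y k), absPow_apply,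
    absPow_apply]
  exact Real.rpow_le_rpow (norm_nonneg _) (h k) (q_pos q).le

lemma qnorm_filter_le (P : ℕ → Prop) [DecidablePred P] (x : ℕ →₀ 𝕜) :
    qnorm q θ (x.filter P) ≤ qnorm q θ x := by
  refine qnorm_mono q θ fun k => ?_
  rw [Finsupp.filter_apply]
  split_ifs <;> simp

lemma tnorm_absPow_le_one {x : ℕ →₀ 𝕜} (hx : qnorm q θ x ≤ 1) :
    tnorm ((θ : ℝ) ^ (q : ℝ)) (absPow q x) ≤ 1 := by
  rw [← qnorm_rpow]
  exact Real.rpow_le_one (qnorm_nonneg _ _ _) hx (q_pos q).le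

/-- The vector $y$ and the average live on disjoint sets of coordinates, and $t\mapsto t^q$ is
convex. Hence averages in $T_{q,\theta}$ are controlled by averages of $q$-th powers in
$T_{\theta^q}$. -/
lemma absPow_add_average_le {r : ℕ} (hr : 0 < r) {m : ℕ} {y : ℕ →₀ 𝕜} {x : Fin r → ℕ →₀ 𝕜}
    (hy : ∀ k ∈ y.support, k < m) (hx : ∀ i, ∀ k ∈ (x i).support, m ≤ k) (k : ℕ) :
    |absPow q (y + (r : 𝕜)⁻¹ • ∑ i, x i) k| ≤
      |(absPow q y + (r : ℝ)⁻¹ • ∑ i, absPow q (x i)) k| := by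
  have hr' : (0 : ℝ) < r := by exact_mod_cast hr
  rw [abs_of_nonneg (absPow_nonneg _ _ _)]
  refine le_trans ?_ (le_abs_self _)
  simp only [Finsupp.add_apply, Finsupp.smul_apply, Finsupp.finsetSum_apply, smul_eq_mul,
    absPow_apply]
  rcases lt_or_ge k m with hk | hk
  · have : ∀ i, x i k = 0 := fun i => by
      rw [← Finsupp.notMem_support_iff]
      exact fun h => absurd (hx i k h) (by omega)
    simp only [this, Finset.sum_const_zero, mul_zero, add_zero]
    exact le_add_of_nonneg_right (mul_nonneg (inv_nonneg.2 hr'.le)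
      (Finset.sum_nonneg fun _ _ => Real.rpow_nonneg (norm_nonneg _) _))
  · have : y k = 0 := by
      rw [← Finsupp.notMem_support_iff]
      exact fun h => absurd (hy k h) (by omega)
    rw [this, zero_add]
    refine le_add_of_nonneg_of_le (Real.rpow_nonneg (norm_nonneg _) _) ?_
    have key := Real.rpow_arith_mean_le_arith_mean_rpow Finset.univ (fun _ : Fin r => (r : ℝ)⁻¹)
      (fun i => ‖x i k‖) (fun _ _ => inv_nonneg.2 hr'.le) (by simp [hr'.ne'])
      (fun _ _ => norm_nonneg _) q.2
    rw [← Finset.mul_sum, ← Finset.mul_sum] at key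
    refine le_trans (Real.rpow_le_rpow (norm_nonneg _) ?_ (q_pos q).le) key
    rw [norm_mul, norm_inv, RCLike.norm_natCast]
    exact mul_le_mul_of_nonneg_left (norm_sum_le _ _) (inv_nonneg.2 hr'.le)

lemma qnorm_add_average_rpow_le {r : ℕ} (hr : 0 < r) {m : ℕ} {y : ℕ →₀ 𝕜} {x : Fin r → ℕ →₀ 𝕜}
    (hs : Succ fun i => (x i).support)
    (hy : ∀ k ∈ y.support, k < m) (hx : ∀ i, ∀ k ∈ (x i).support, m ≤ k)
    (hy1 : qnorm q θ y ≤ 1) (hx1 : ∀ i, qnorm q θ (x i) ≤ 1) :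
    qnorm q θ (y + (r : 𝕜)⁻¹ • ∑ i, x i) ^ (q : ℝ) ≤ 1 + (θ : ℝ) ^ (q : ℝ) + m / r := by
  rw [qnorm_rpow]
  refine (tnorm_mono (par_nonneg q θ) (par_le_one q θ) (absPow_add_average_le q hr hy hx)).trans ?_
  refine tnorm_add_average_le (par_pos q θ) (par_le_one q θ) hr (by simpa only [support_absPow])
    (by simpa only [support_absPow]) (by simpa only [support_absPow])
    (tnorm_absPow_le_one q θ hy1) fun i => tnorm_absPow_le_one q θ (hx1 i)

/-- The inclusion of `c_00` into `T_{q,θ}`. -/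
noncomputable def emb (𝕜 : Type u) [RCLike 𝕜] (q : Set.Ici (1 : ℝ)) (θ : Set.Ioo (0 : ℝ) 1) :
    (ℕ →₀ 𝕜) →ₗ[𝕜] TsirelsonSpace 𝕜 q θ :=
  (UniformSpace.Completion.toComplL (𝕜 := 𝕜) (E := TsirelsonPre 𝕜 q θ)).toLinearMap

lemma norm_emb (x : ℕ →₀ 𝕜) : ‖emb 𝕜 q θ x‖ = qnorm q θ x :=
  UniformSpace.Completion.norm_coe (E := TsirelsonPre 𝕜 q θ) x

lemma denseRange_emb : DenseRange (emb 𝕜 q θ) :=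
  UniformSpace.Completion.denseRange_coe (α := TsirelsonPre 𝕜 q θ)

variable {q θ}

lemma norm_dual_le {f : TsirelsonDual 𝕜 q θ} {C : ℝ} (hC : 0 ≤ C)
    (h : ∀ x, ‖f (emb 𝕜 q θ x)‖ ≤ C * qnorm q θ x) : ‖f‖ ≤ C := by
  refine f.opNorm_le_bound hC fun z => ?_
  refine (denseRange_emb (𝕜 := 𝕜) q θ).induction_on z (isClosed_le (by fun_prop) (by fun_prop))
    fun x => ?_
  rw [norm_emb]
  exact h x

lemma norm_dual_apply_le (f : TsirelsonDual 𝕜 q θ) (x : ℕ →₀ 𝕜) :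
    ‖f (emb 𝕜 q θ x)‖ ≤ ‖f‖ * qnorm q θ x := by
  rw [← norm_emb]
  exact f.le_opNorm _

/-- The `k`-th coordinate as a bounded functional on `c_00` with the norm of `T_{q,θ}`. -/
noncomputable def preCoord (𝕜 : Type u) [RCLike 𝕜] (q : Set.Ici (1 : ℝ)) (θ : Set.Ioo (0 : ℝ) 1) (k : ℕ) :
    StrongDual 𝕜 (TsirelsonPre 𝕜 q θ) :=
  LinearMap.mkContinuous (show TsirelsonPre 𝕜 q θ →ₗ[𝕜] 𝕜 from
    (Finsupp.lapply k : (ℕ →₀ 𝕜) →ₗ[𝕜] 𝕜)) 1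
    fun x => by rw [one_mul]; exact norm_le_qnorm (𝕜 := 𝕜) q θ x k

/-- The functional on `T_{q,θ}` given by the `k`-th coordinate. -/
noncomputable def coord (𝕜 : Type u) [RCLike 𝕜] (q : Set.Ici (1 : ℝ)) (θ : Set.Ioo (0 : ℝ) 1) (k : ℕ) :
    TsirelsonDual 𝕜 q θ :=
  (preCoord 𝕜 q θ k).extend (UniformSpace.Completion.toComplL (𝕜 := 𝕜) (E := TsirelsonPre 𝕜 q θ))

lemma coord_emb (k : ℕ) (x : ℕ →₀ 𝕜) : coord 𝕜 q θ k (emb 𝕜 q θ x) = x k :=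
  (preCoord 𝕜 q θ k).extend_eq
    (e := UniformSpace.Completion.toComplL (𝕜 := 𝕜) (E := TsirelsonPre 𝕜 q θ))
    UniformSpace.Completion.denseRange_coe
    (UniformSpace.Completion.isUniformInducing_coe _) x

lemma norm_coord_le (k : ℕ) : ‖coord 𝕜 q θ k‖ ≤ 1 :=
  norm_dual_le zero_le_one fun x => by
    rw [coord_emb, one_mul]
    exact norm_le_qnorm q θ x k

/-- `f` has norm at most `c` on the vectors supported on `[N, ∞)`. -/
def TailBound (f : TsirelsonDual 𝕜 q θ) (c : ℝ) (N : ℕ) : Prop :=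
  ∀ x : ℕ →₀ 𝕜, (∀ k ∈ x.support, N ≤ k) → ‖f (emb 𝕜 q θ x)‖ ≤ c * qnorm q θ x

lemma exists_of_not_tailBound {f : TsirelsonDual 𝕜 q θ} {c : ℝ} {N : ℕ}
    (h : ¬ TailBound f c N) : ∃ x : ℕ →₀ 𝕜, (∀ k ∈ x.support, N ≤ k) ∧ qnorm q θ x ≤ 1 ∧
      c ≤ RCLike.re (f (emb 𝕜 q θ x)) := by
  simp only [TailBound, not_forall, not_le] at h
  obtain ⟨x, hx, hlt⟩ := h
  have hpos : 0 < qnorm q θ x := by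
    refine (qnorm_nonneg q θ x).lt_of_ne fun h => ?_
    rw [eq_zero_of_qnorm q θ h.symm, map_zero, map_zero, norm_zero, qnorm_zero, mul_zero] at hlt
    exact lt_irrefl _ hlt
  obtain ⟨a, ha, hax⟩ := RCLike.exists_norm_eq_mul_self (f (emb 𝕜 q θ x))
  refine ⟨(((qnorm q θ x)⁻¹ : ℝ) * a) • x, fun k hk => hx k (Finsupp.support_smul hk), ?_, ?_⟩
  · rw [qnorm_smul, norm_mul, ha, mul_one, RCLike.norm_of_nonneg (inv_nonneg.2 hpos.le),
      inv_mul_cancel₀ hpos.ne']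
  · rw [map_smul, map_smul, smul_eq_mul, mul_assoc, ← hax, ← RCLike.ofReal_mul, RCLike.ofReal_re,
      le_inv_mul_iff₀ hpos]
    linarith

/-- The unit vector basis of `T_{q,θ}` is shrinking. -/
lemma exists_tailBound (f : TsirelsonDual 𝕜 q θ) {ε : ℝ} (hε : 0 < ε) : ∃ N, TailBound f ε N := by
  -- The infimum `s` is the limit of the norms of `f` on tails; the aim is a contradiction from
  -- $s\ge\varepsilon$.
  set S : Set ℝ := {c | 0 ≤ c ∧ ∃ N, TailBound f c N} with hS
  have hne : S.Nonempty := ⟨‖f‖, norm_nonneg _, 0, fun x _ => norm_dual_apply_le f x⟩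
  have hbd : BddBelow S := ⟨0, fun c hc => hc.1⟩
  set s := sInf S with hs
  have hmono : ∀ {c c' N}, c ≤ c' → TailBound f c N → TailBound f c' N := fun hcc h x hx =>
    (h x hx).trans (mul_le_mul_of_nonneg_right hcc (qnorm_nonneg _ _ _))
  by_contra hno
  push Not at hno
  have hsε : ε ≤ s := by
    refine le_csInf hne ?_
    rintro c ⟨-, N, hN⟩
    by_contra! hlt
    exact hno N (hmono hlt.le hN)
  have hs0 : 0 < s := hε.trans_le hsε
  set τ := (θ : ℝ) ^ (q : ℝ) with hτ
  have hτ0 : 0 < τ := par_pos q θ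
  have hτ1 : τ < 1 := par_lt_one q θ
  -- With this choice $8\delta=(1-\tau)/2$, so the lower bound $2-4\delta$ and the strict upper
  -- bound $1+\tau+(1-\tau)/2=2-8\delta$ for $\|y\|$ are incompatible.
  set δ := (1 - τ) / 16 with hδ
  have hδ0 : 0 < δ := by rw [hδ]; linarith
  obtain ⟨c, ⟨hc0, N₀, hN₀⟩, hc⟩ := exists_lt_of_csInf_lt hne
    (show sInf S < (1 + δ) * s by rw [← hs]; nlinarith)
  have hδ1 : 0 ≤ (1 - δ) * s := mul_nonneg (by rw [hδ]; linarith) hs0.le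
  have hw : ∀ N, ∃ x : ℕ →₀ 𝕜, (∀ k ∈ x.support, N ≤ k) ∧ qnorm q θ x ≤ 1 ∧
      (1 - δ) * s ≤ RCLike.re (f (emb 𝕜 q θ x)) := fun N =>
    exists_of_not_tailBound fun h => by
      have : s ≤ (1 - δ) * s := csInf_le hbd ⟨hδ1, N, h⟩
      nlinarith
  choose w hwN hw1 hwf using hw
  set K : ℕ → ℕ := fun i => Nat.rec N₀ (fun _ k => max k ((w k).support.sup id + 1)) i with hK
  have hKs : ∀ i, K (i + 1) = max (K i) ((w (K i)).support.sup id + 1) := fun i => rfl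
  have hKm : Monotone K := monotone_nat_of_le_succ fun i => by rw [hKs]; exact le_max_left _ _
  have hKw : ∀ i, ∀ k ∈ (w (K i)).support, K i ≤ k ∧ k < K (i + 1) := fun i k hk => by
    refine ⟨hwN _ k hk, ?_⟩
    have : k ≤ (w (K i)).support.sup id := Finset.le_sup (f := id) hk
    rw [hKs]
    exact lt_max_of_lt_right (by omega)
  obtain ⟨r, hr⟩ := exists_nat_gt (K 1 / ((1 - τ) / 2))
  have hτ2 : 0 < (1 - τ) / 2 := by linarith
  have hr' : (0 : ℝ) < r := (div_nonneg (Nat.cast_nonneg _) hτ2.le).trans_lt hr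
  have hr0 : 0 < r := by exact_mod_cast hr'
  -- On one nearly norming vector plus an average of many later ones `f` is almost $2s$, whereas
  -- $\|y\|^q$ stays below a number smaller than $2$ once $r$ is large compared with $K_1$.
  set y := w (K 0) + (r : 𝕜)⁻¹ • ∑ i : Fin r, w (K (i + 1)) with hy
  have hup : qnorm q θ y ^ (q : ℝ) ≤ 1 + τ + K 1 / r := by
    refine qnorm_add_average_rpow_le q θ hr0
      (succ_of_mem_Ico (K := fun i => K (i + 1)) (fun i j hij => hKm (Nat.succ_le_succ hij))
        fun i : Fin r => hKw (i + 1)) (fun k hk => (hKw 0 k hk).2)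
      (fun i k hk => (hKm (Nat.succ_le_succ (Nat.zero_le i))).trans (hKw (i + 1) k hk).1) (hw1 _) fun i => hw1 _
  have hysupp : ∀ k ∈ y.support, N₀ ≤ k := by
    intro k hk
    by_contra! hlt
    rw [Finsupp.mem_support_iff] at hk
    refine hk ?_
    have hz : ∀ i, w (K i) k = 0 := fun i => by
      rw [← Finsupp.notMem_support_iff]
      intro h
      have h1 := (hKw i k h).1
      have h2 : K 0 ≤ K i := hKm (Nat.zero_le _)
      have h3 : K 0 = N₀ := rfl
      omega
    simp only [hy, Finsupp.add_apply, Finsupp.smul_apply, Finsupp.finsetSum_apply, hz,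
      Finset.sum_const_zero, smul_zero, add_zero]
  have hlow : 2 * ((1 - δ) * s) ≤ RCLike.re (f (emb 𝕜 q θ y)) := by
    have h1 : (r : 𝕜)⁻¹ = (((r : ℝ)⁻¹ : ℝ) : 𝕜) := by push_cast; rfl
    rw [hy, map_add, map_add, map_add, map_smul, map_smul, map_sum, map_sum, smul_eq_mul, h1,
      RCLike.re_ofReal_mul, map_sum]
    have h2 : (1 - δ) * s ≤
        (r : ℝ)⁻¹ * ∑ i : Fin r, RCLike.re (f (emb 𝕜 q θ (w (K (i + 1))))) := by
      rw [le_inv_mul_iff₀ hr']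
      calc (r : ℝ) * ((1 - δ) * s) = ∑ i : Fin r, (1 - δ) * s := by simp
        _ ≤ _ := Finset.sum_le_sum fun i _ => hwf _
    linarith [hwf (K 0)]
  have hfy : 2 * ((1 - δ) * s) ≤ (1 + δ) * s * qnorm q θ y :=
    hlow.trans ((RCLike.re_le_norm _).trans ((hN₀ y hysupp).trans
      (mul_le_mul_of_nonneg_right hc.le (qnorm_nonneg _ _ _))))
  have hqy : 2 - 4 * δ ≤ qnorm q θ y := by
    have h1 : 2 * (1 - δ) ≤ (1 + δ) * qnorm q θ y := by
      refine le_of_mul_le_mul_right ?_ hs0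
      linarith
    have h2 : (1 + δ) * (2 - 4 * δ) ≤ 2 * (1 - δ) := by nlinarith
    exact le_of_mul_le_mul_left (h2.trans h1) (by linarith)
  have h1y : 1 ≤ qnorm q θ y := le_trans (by rw [hδ]; linarith) hqy
  have h2y : qnorm q θ y ≤ qnorm q θ y ^ (q : ℝ) := Real.self_le_rpow_of_one_le h1y q.2
  have h3 : (K 1 : ℝ) / r < (1 - τ) / 2 := by
    rw [div_lt_iff₀ hτ2] at hr
    rw [div_lt_iff₀ hr']
    linarith
  rw [hδ] at hqy
  linarith

end Tsirelson

/-! ### Hölder's inequality for conjugate exponents, including $p=\infty$ -/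

section Hoelder

variable {𝕜 : Type u} [RCLike 𝕜] {p : ℝ≥0∞} {q : Set.Ici (1 : ℝ)}

lemma toReal_inv_add_inv (hpq : p.HolderConjugate (ENNReal.ofReal (q : ℝ))) :
    (p⁻¹).toReal + 1 / (q : ℝ) = 1 := by
  have hq : (0 : ℝ) < q := zero_lt_one.trans_le q.2
  have h := ENNReal.HolderConjugate.inv_add_inv_eq_one p (ENNReal.ofReal (q : ℝ))
  have h2 := congrArg ENNReal.toReal h
  have hp : p⁻¹ ≠ ∞ := fun hp => by simp [hp] at h
  rw [ENNReal.toReal_add hp (by simp [hq])] at h2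
  rw [ENNReal.toReal_inv (ENNReal.ofReal (q : ℝ)), ENNReal.toReal_ofReal hq.le] at h2
  simpa using h2

lemma eq_one_of_top (hpq : (∞ : ℝ≥0∞).HolderConjugate (ENNReal.ofReal (q : ℝ))) : (q : ℝ) = 1 := by
  have := toReal_inv_add_inv hpq
  simpa using this

lemma real_holderConjugate (hp : p ≠ ∞) (hp1 : 1 < p)
    (hpq : p.HolderConjugate (ENNReal.ofReal (q : ℝ))) : p.toReal.HolderConjugate q := by
  refine Real.holderConjugate_iff.2 ⟨?_, ?_⟩
  · rw [← ENNReal.toReal_one]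
    exact (ENNReal.toReal_lt_toReal ENNReal.one_ne_top hp).2 hp1
  · have := toReal_inv_add_inv hpq
    rwa [ENNReal.toReal_inv, one_div] at this

lemma sum_norm_mul_le (hp : 1 < p) (hpq : p.HolderConjugate (ENNReal.ofReal (q : ℝ))) {n : ℕ}
    {a : PiLp p (fun _ : Fin n => 𝕜)} (ha : ‖a‖ ≤ 1) {b : Fin n → ℝ} (hb : ∀ i, 0 ≤ b i) :
    ∑ i, ‖a i‖ * b i ≤ (∑ i, b i ^ (q : ℝ)) ^ (1 / (q : ℝ)) := by
  rcases eq_or_ne p ∞ with rfl | hpt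
  · rw [eq_one_of_top hpq]
    simp only [Real.rpow_one, one_div, inv_one]
    refine Finset.sum_le_sum fun i _ => ?_
    exact mul_le_of_le_one_left (hb i) ((PiLp.norm_apply_le a i).trans ha)
  · have hr := real_holderConjugate hpt hp hpq
    refine (Real.inner_le_Lp_mul_Lq_of_nonneg Finset.univ hr (fun i _ => norm_nonneg _)
      fun i _ => hb i).trans ?_
    rw [← PiLp.norm_eq_sum hr.pos]
    exact mul_le_of_le_one_left (Real.rpow_nonneg
      (Finset.sum_nonneg fun i _ => Real.rpow_nonneg (hb i) _) _) ha

/-- The flat vectors of the unit ball of `ℓ_p^n`. -/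
lemma norm_flat_le_one (hp : 1 < p) {n : ℕ} {c : Fin n → 𝕜} (hc : ∀ i, ‖c i‖ ≤ 1) :
    ‖(WithLp.toLp p fun i => ((((n : ℝ) ^ (p⁻¹).toReal)⁻¹ : ℝ) : 𝕜) * c i :
      PiLp p (fun _ : Fin n => 𝕜))‖ ≤ 1 := by
  rcases eq_or_ne p ∞ with rfl | hpt
  · rw [PiLp.norm_eq_ciSup]
    refine Real.iSup_le (fun i => ?_) zero_le_one
    simpa using hc i
  · have hp0 : 0 < p.toReal := ENNReal.toReal_pos (zero_lt_one.trans hp).ne' hpt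
    rw [PiLp.norm_eq_sum hp0]
    refine Real.rpow_le_one (Finset.sum_nonneg fun i _ => Real.rpow_nonneg (norm_nonneg _) _) ?_
      (one_div_nonneg.2 hp0.le)
    rcases Nat.eq_zero_or_pos n with rfl | hn
    · simp
    have hn' : (0 : ℝ) < n := by exact_mod_cast hn
    have hle : ∀ i, ‖((((n : ℝ) ^ (p⁻¹).toReal)⁻¹ : ℝ) : 𝕜) * c i‖ ^ p.toReal ≤ (n : ℝ)⁻¹ := by
      intro i
      have h1 : ‖((((n : ℝ) ^ (p⁻¹).toReal)⁻¹ : ℝ) : 𝕜) * c i‖ ≤ ((n : ℝ) ^ (p⁻¹).toReal)⁻¹ := by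
        rw [norm_mul, RCLike.norm_of_nonneg (by positivity)]
        exact mul_le_of_le_one_right (by positivity) (hc i)
      refine (Real.rpow_le_rpow (norm_nonneg _) h1 hp0.le).trans_eq ?_
      rw [Real.inv_rpow (by positivity), ← Real.rpow_mul hn'.le, ENNReal.toReal_inv,
        inv_mul_cancel₀ hp0.ne', Real.rpow_one]
    refine (Finset.sum_le_sum fun i _ => hle i).trans ?_
    simp [hn'.ne']

end Hoelder

/-! ### Upper $p$-estimates in the dual: $\mathsf A_p$, separability, weak nullity of coordinates -/

namespace Tsirelson

variable {𝕜 : Type u} [RCLike 𝕜] {p : ℝ≥0∞} {q : Set.Ici (1 : ℝ)} {θ : Set.Ioo (0 : ℝ) 1}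

/-- The lower `q`-estimate on admissible blocks, in dual form. -/
lemma Adm.sum_norm_mul_qnorm_le (hp : 1 < p) (hpq : p.HolderConjugate (ENNReal.ofReal (q : ℝ)))
    {n : ℕ} {E : Fin n → Finset ℕ} (hE : Adm E) {a : PiLp p (fun _ : Fin n => 𝕜)} (ha : ‖a‖ ≤ 1)
    (x : ℕ →₀ 𝕜) :
    ∑ i, ‖a i‖ * qnorm q θ (x.filter (· ∈ E i)) ≤ (θ : ℝ)⁻¹ * qnorm q θ x := by
  have hq := q_pos q
  have hθ : (0 : ℝ) < θ := θ.2.1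
  refine (sum_norm_mul_le hp hpq ha fun i => qnorm_nonneg _ _ _).trans ?_
  simp only [qnorm_rpow, absPow_filter]
  have key := hE.mul_sum_tnorm_le (par_nonneg q θ) (par_le_one q θ) (absPow q x)
  -- The parameter $\theta^q$ of the Tsirelson norm becomes $\theta$ after the $q$-th root.
  have h1 : (θ : ℝ)⁻¹ * qnorm q θ x =
      (((θ : ℝ) ^ (q : ℝ))⁻¹ * tnorm ((θ : ℝ) ^ (q : ℝ)) (absPow q x)) ^ (1 / (q : ℝ)) := by
    rw [Real.mul_rpow (inv_nonneg.2 (par_nonneg q θ)) (tnorm_nonneg _ _), qnorm,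
      Real.inv_rpow (par_nonneg q θ), ← Real.rpow_mul hθ.le, mul_one_div_cancel hq.ne',
      Real.rpow_one]
  rw [h1]
  refine Real.rpow_le_rpow (Finset.sum_nonneg fun _ _ => tnorm_nonneg _ _) ?_
    (one_div_nonneg.2 hq.le)
  rwa [le_inv_mul_iff₀ (par_pos q θ)]

lemma apply_emb_eq_sum (f : TsirelsonDual 𝕜 q θ) {x : ℕ →₀ 𝕜} {S : Finset ℕ} (h : x.support ⊆ S) :
    f (emb 𝕜 q θ x) = ∑ k ∈ S, x k * f (emb 𝕜 q θ (Finsupp.single k 1)) := by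
  have hx : x = ∑ k ∈ S, x k • Finsupp.single k (1 : 𝕜) := by
    conv_lhs => rw [← Finsupp.sum_single x, Finsupp.sum]
    simp only [Finsupp.smul_single, smul_eq_mul, mul_one]
    exact Finset.sum_subset h fun k _ hk => by
      rw [Finsupp.notMem_support_iff.1 hk, Finsupp.single_zero]
  conv_lhs => rw [hx]
  simp only [map_sum, map_smul, smul_eq_mul]

lemma apply_emb_filter_lt (f : TsirelsonDual 𝕜 q θ) (x : ℕ →₀ 𝕜) (N : ℕ) :
    f (emb 𝕜 q θ (x.filter (· < N))) =
      ∑ k ∈ Finset.range N, x k * f (emb 𝕜 q θ (Finsupp.single k 1)) := by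
  rw [apply_emb_eq_sum f (S := Finset.range N)]
  · refine Finset.sum_congr rfl fun k hk => ?_
    rw [Finsupp.filter_apply, if_pos (Finset.mem_range.1 hk)]
  · intro k hk
    rw [Finsupp.support_filter, Finset.mem_filter] at hk
    exact Finset.mem_range.2 hk.2

/-- A functional that is small on the first $N$ coordinates and on the tail beyond $M$ acts, up to
$2\varepsilon$, only on the block $[N,M)$. The head has $N$ coordinates contributing at most
$\varepsilon/(N+1)$ each. -/
lemma norm_apply_le_of_small {f : TsirelsonDual 𝕜 q θ} (hf : ‖f‖ ≤ 1) {N M : ℕ} (hNM : N ≤ M)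
    {ε : ℝ} (hε : 0 ≤ ε) (h1 : ∀ k < N, ‖f (emb 𝕜 q θ (Finsupp.single k 1))‖ < ε / (N + 1))
    (h2 : TailBound f ε M) (x : ℕ →₀ 𝕜) :
    ‖f (emb 𝕜 q θ x)‖ ≤ 2 * ε * qnorm q θ x + qnorm q θ (x.filter (· ∈ Finset.Ico N M)) := by
  have hx : x = x.filter (· < N) + x.filter (· ∈ Finset.Ico N M) + x.filter (M ≤ ·) := by
    ext k
    simp only [Finsupp.add_apply, Finsupp.filter_apply, Finset.mem_Ico]
    rcases lt_or_ge k N with hk | hk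
    · rw [if_pos hk, if_neg (by omega), if_neg (by omega), add_zero, add_zero]
    rcases lt_or_ge k M with hk' | hk'
    · rw [if_neg (by omega), if_pos ⟨hk, hk'⟩, if_neg (by omega), add_zero, zero_add]
    · rw [if_neg (by omega), if_neg (by omega), if_pos hk', zero_add, zero_add]
  have hq := qnorm_nonneg q θ x
  have hA : ‖f (emb 𝕜 q θ (x.filter (· < N)))‖ ≤ ε * qnorm q θ x := by
    rw [apply_emb_filter_lt]
    calc ‖∑ k ∈ Finset.range N, x k * f (emb 𝕜 q θ (Finsupp.single k 1))‖
        ≤ ∑ k ∈ Finset.range N, qnorm q θ x * (ε / (N + 1)) := by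
          refine (norm_sum_le _ _).trans (Finset.sum_le_sum fun k hk => ?_)
          rw [norm_mul]
          exact mul_le_mul (norm_le_qnorm q θ x k) (h1 k (Finset.mem_range.1 hk)).le
            (norm_nonneg _) hq
      _ = N / (N + 1) * (ε * qnorm q θ x) := by
          rw [Finset.sum_const, Finset.card_range, nsmul_eq_mul]
          ring
      _ ≤ ε * qnorm q θ x :=
          mul_le_of_le_one_left (mul_nonneg hε hq) (div_le_one_of_le₀ (by linarith) (by positivity))
  have hB : ‖f (emb 𝕜 q θ (x.filter (· ∈ Finset.Ico N M)))‖ ≤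
      qnorm q θ (x.filter (· ∈ Finset.Ico N M)) :=
    (norm_dual_apply_le f _).trans (mul_le_of_le_one_left (qnorm_nonneg _ _ _) hf)
  have hC : ‖f (emb 𝕜 q θ (x.filter (M ≤ ·)))‖ ≤ ε * qnorm q θ x := by
    refine (h2 _ fun k hk => ?_).trans (mul_le_mul_of_nonneg_left (qnorm_filter_le _ _ _ _) hε)
    rw [Finsupp.support_filter, Finset.mem_filter] at hk
    exact hk.2
  conv_lhs => rw [hx, map_add, map_add, map_add, map_add]
  linarith [norm_add₃_le (a := f (emb 𝕜 q θ (x.filter (· < N))))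
    (b := f (emb 𝕜 q θ (x.filter (· ∈ Finset.Ico N M)))) (c := f (emb 𝕜 q θ (x.filter (M ≤ ·))))]

lemma winsA (hp : 1 < p) (hpq : p.HolderConjugate (ENNReal.ofReal (q : ℝ))) (n : ℕ) :
    WinsA 𝕜 p (TsirelsonDual 𝕜 q θ) ((θ : ℝ)⁻¹ + 1) n := by
  classical
  have : Fact (1 ≤ p) := ⟨hp.le⟩
  -- The $n$ moves produce a total error $2n\varepsilon\le1$, the summand $1$ in the constant.
  set ε : ℝ := (2 * (n + 1))⁻¹ with hε
  have hε0 : 0 < ε := by positivity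
  choose g hg using fun f : TsirelsonDual 𝕜 q θ => exists_tailBound f hε0
  set ev : ℕ → StrongDual 𝕜 (TsirelsonDual 𝕜 q θ) := fun k =>
    ContinuousLinearMap.apply 𝕜 𝕜 (emb 𝕜 q θ (Finsupp.single k 1)) with hev
  -- The next block starts beyond the essential supports of all earlier moves. The initial summand
  -- `n` makes the `n` blocks admissible.
  set N : (k : ℕ) → (Fin k → TsirelsonDual 𝕜 q θ) → ℕ := fun k h => n + ∑ l, g (h l) with hN
  refine ⟨fun k h => weakNhdOfFinset ((Finset.range (N k h)).image ev)
    (show 0 < ε / (N k h + 1) by positivity), fun f hf a ha => ?_⟩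
  have hθ : (0 : ℝ) < θ := θ.2.1
  set F : ℕ → TsirelsonDual 𝕜 q θ := fun i => if h : i < n then f ⟨i, h⟩ else 0 with hF
  set M : ℕ → ℕ := fun i => n + ∑ l ∈ Finset.range i, g (F l) with hM
  have hMm : Monotone M := fun i j hij => by
    have := Finset.sum_le_sum_of_subset (f := fun l => g (F l)) (Finset.range_mono hij)
    simp only [hM]
    omega
  have hMN : ∀ j : Fin n, N j (fun i : Fin j => f ⟨i, i.isLt.trans j.isLt⟩) = M j := by
    intro j
    simp only [hN, hM, ← Fin.sum_univ_eq_sum_range]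
    congr 1
    refine Finset.sum_congr rfl fun i _ => ?_
    rw [hF]
    simp only [i.isLt.trans j.isLt, dif_pos]
  have hsmall : ∀ (j : Fin n), ∀ k < M j, ‖f j (emb 𝕜 q θ (Finsupp.single k 1))‖ < ε / (M j + 1) := by
    intro j k hk
    have := (hf j).2
    rw [mem_weakNhdOfFinset, hMN] at this
    exact this (ev k) (Finset.mem_image_of_mem _ (Finset.mem_range.2 hk))
  have htail : ∀ j : Fin n, TailBound (f j) ε (M (j + 1)) := by
    intro j x hx
    refine hg (f j) x fun k hk => le_trans ?_ (hx k hk)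
    have h1 : F j = f j := by simp [hF]
    rw [hM]
    simp only [Finset.sum_range_succ, h1]
    omega
  have hE : Adm fun i : Fin n => Finset.Ico (M i) (M (i + 1)) := by
    refine ⟨fun i k hk => ?_, succ_of_mem_Ico hMm fun i k hk => Finset.mem_Ico.1 hk⟩
    have h1 := (Finset.mem_Ico.1 hk).1
    have h2 : n ≤ M i := Nat.le_add_right _ _
    omega
  refine norm_dual_le (by positivity) fun x => ?_
  have hqx := qnorm_nonneg q θ x
  rw [_root_.sum_apply]
  calc ‖∑ i, (a i • f i) (emb 𝕜 q θ x)‖ ≤ ∑ i, ‖(a i • f i) (emb 𝕜 q θ x)‖ := norm_sum_le _ _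
    _ ≤ ∑ i, (2 * ε * qnorm q θ x +
          ‖a i‖ * qnorm q θ (x.filter (· ∈ Finset.Ico (M i) (M (i + 1))))) := by
        refine Finset.sum_le_sum fun i _ => ?_
        have hai : ‖a i‖ ≤ 1 := (PiLp.norm_apply_le a i).trans ha
        rw [_root_.smul_apply, norm_smul]
        have h1 := mul_le_mul_of_nonneg_left (norm_apply_le_of_small (hf i).1
          (hMm (Nat.le_succ i)) hε0.le (hsmall i) (htail i) x) (norm_nonneg (a i))
        have h2 : ‖a i‖ * (2 * ε * qnorm q θ x) ≤ 2 * ε * qnorm q θ x :=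
          mul_le_of_le_one_left (by positivity) hai
        linarith
    _ = n * (2 * ε * qnorm q θ x) +
          ∑ i, ‖a i‖ * qnorm q θ (x.filter (· ∈ Finset.Ico (M i) (M (i + 1)))) := by
        rw [Finset.sum_add_distrib]
        simp
    _ ≤ 1 * qnorm q θ x + (θ : ℝ)⁻¹ * qnorm q θ x := by
        refine add_le_add ?_ (hE.sum_norm_mul_qnorm_le hp hpq ha x)
        rw [← mul_assoc]
        refine mul_le_mul_of_nonneg_right ?_ hqx
        rw [hε]
        field_simp
        linarith
    _ = ((θ : ℝ)⁻¹ + 1) * qnorm q θ x := by ring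

/-- Since the basis is shrinking, the partial sums $\sum_{k<N}f(e_k)e_k^*$ converge to $f$ in norm.
-/
lemma separableSpace_dual : TopologicalSpace.SeparableSpace (TsirelsonDual 𝕜 q θ) := by
  rw [← TopologicalSpace.isSeparable_univ_iff]
  have h1 : TopologicalSpace.IsSeparable
      (Submodule.span 𝕜 (Set.range (coord 𝕜 q θ)) : Set (TsirelsonDual 𝕜 q θ)) :=
    (Set.countable_range _).isSeparable.span
  refine h1.closure.mono fun f _ => ?_
  rw [Metric.mem_closure_iff]
  intro ε hε
  obtain ⟨N, hN⟩ := exists_tailBound f (half_pos hε)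
  refine ⟨∑ k ∈ Finset.range N, f (emb 𝕜 q θ (Finsupp.single k 1)) • coord 𝕜 q θ k,
    Submodule.sum_mem _ fun k _ => Submodule.smul_mem _ _ (Submodule.subset_span ⟨k, rfl⟩), ?_⟩
  rw [dist_eq_norm]
  refine (norm_dual_le (half_pos hε).le fun x => ?_).trans_lt (half_lt_self hε)
  have hx : x = x.filter (· < N) + x.filter (fun k => ¬ k < N) :=
    (Finsupp.filter_add_filter_not x _).symm
  have : (f - ∑ k ∈ Finset.range N, f (emb 𝕜 q θ (Finsupp.single k 1)) • coord 𝕜 q θ k)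
      (emb 𝕜 q θ x) = f (emb 𝕜 q θ (x.filter (fun k => ¬ k < N))) := by
    rw [_root_.sub_apply, _root_.sum_apply]
    simp only [_root_.smul_apply, coord_emb, smul_eq_mul]
    conv_lhs => rw [hx, map_add, map_add, apply_emb_filter_lt, ← hx]
    rw [add_sub_right_comm, sub_eq_zero.2, zero_add]
    exact Finset.sum_congr rfl fun k _ => mul_comm _ _
  rw [this]
  refine (hN _ fun k hk => ?_).trans (mul_le_mul_of_nonneg_left (qnorm_filter_le _ _ _ _)
    (half_pos hε).le)
  rw [Finsupp.support_filter, Finset.mem_filter] at hk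
  exact not_lt.1 hk.2

lemma linearIndependent_coord : LinearIndependent 𝕜 (coord 𝕜 q θ) := by
  rw [linearIndependent_iff']
  intro s c h i hi
  have h1 := congrArg (fun f : TsirelsonDual 𝕜 q θ => f (emb 𝕜 q θ (Finsupp.single i 1))) h
  simpa [_root_.sum_apply, coord_emb, Finsupp.single_apply, hi] using h1

lemma not_finiteDimensional_dual : ¬ FiniteDimensional 𝕜 (TsirelsonDual 𝕜 q θ) := fun _ =>
  Module.Finite.not_linearIndependent_of_infinite (coord 𝕜 q θ) linearIndependent_coord

open Filter Topology in
-- If $|g(e_k^*)|\ge\delta$ for infinitely many $k$, a unimodular combination $v$ of $n$ such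
-- functionals has $|g(v)|\ge n\delta$, while the dual estimate gives $\|v\|\le n^{1/p}\theta^{-1}$.
-- As $1/p<1$, this fails for large $n$.
lemma tendsto_apply_coord (hp : 1 < p) (hpq : p.HolderConjugate (ENNReal.ofReal (q : ℝ)))
    (g : StrongDual 𝕜 (TsirelsonDual 𝕜 q θ)) :
    Tendsto (fun k => g (coord 𝕜 q θ k)) atTop (𝓝 0) := by
  by_contra hnot
  simp only [Metric.tendsto_nhds, not_forall, not_eventually, dist_zero_right, not_lt] at hnot
  obtain ⟨δ, hδ, hfreq⟩ := hnot
  obtain ⟨φ, hφ, hφδ⟩ := extraction_of_frequently_atTop hfreq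
  have hθ : (0 : ℝ) < θ := θ.2.1
  set s := (p⁻¹).toReal with hs
  have hbound : ∀ n : ℕ, n * δ ≤ ‖g‖ * ((n : ℝ) ^ s * (θ : ℝ)⁻¹) := by
    intro n
    rcases Nat.eq_zero_or_pos n with rfl | hn
    · simp only [Nat.cast_zero, zero_mul]
      positivity
    have hn' : (0 : ℝ) < n := by exact_mod_cast hn
    have hns : (0 : ℝ) < (n : ℝ) ^ s := Real.rpow_pos_of_pos hn' _
    choose c hc hcg using fun k => RCLike.exists_norm_eq_mul_self (g (coord 𝕜 q θ k))
    set v : TsirelsonDual 𝕜 q θ := ∑ i : Fin n, c (φ (n + i)) • coord 𝕜 q θ (φ (n + i)) with hv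
    -- The index shift by `n` is what makes these `n` singletons admissible, since $\varphi(n+i)\ge
    -- n+i$.
    have hE : Adm fun i : Fin n => ({φ (n + i)} : Finset ℕ) := by
      refine ⟨fun i k hk => ?_, fun i j hij k hk m hm => ?_⟩
      · rw [Finset.mem_singleton.1 hk]
        have := hφ.le_apply (x := n + i)
        omega
      · rw [Finset.mem_singleton.1 hk, Finset.mem_singleton.1 hm]
        exact hφ (by simpa using hij)
    have hvn : ‖v‖ ≤ (n : ℝ) ^ s * (θ : ℝ)⁻¹ := by
      refine norm_dual_le (by positivity) fun x => ?_
      rw [mul_assoc, ← inv_mul_le_iff₀ hns]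
      refine le_trans ?_ (hE.sum_norm_mul_qnorm_le hp hpq
        (norm_flat_le_one (c := fun i : Fin n => c (φ (n + i))) hp fun i => (hc _).le) x)
      rw [hv, _root_.sum_apply, inv_mul_le_iff₀ hns, Finset.mul_sum]
      refine (norm_sum_le _ _).trans (Finset.sum_le_sum fun i _ => ?_)
      rw [_root_.smul_apply, coord_emb, norm_smul, hc, one_mul]
      simp only [norm_mul, hc, mul_one]
      rw [RCLike.norm_of_nonneg (inv_nonneg.2 hns.le), mul_inv_cancel_left₀ hns.ne']
      have := norm_le_qnorm q θ (x.filter (· ∈ ({φ (n + i)} : Finset ℕ))) (φ (n + i))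
      rwa [Finsupp.filter_apply_pos _ _ (Finset.mem_singleton_self _)] at this
    have hgv : (n : ℝ) * δ ≤ ‖g v‖ := by
      refine le_trans ?_ (RCLike.re_le_norm _)
      rw [hv, map_sum, map_sum]
      calc (n : ℝ) * δ = ∑ i : Fin n, δ := by simp
        _ ≤ _ := Finset.sum_le_sum fun i _ => ?_
      rw [map_smul, smul_eq_mul, ← hcg, RCLike.ofReal_re]
      exact hφδ _
    exact hgv.trans (g.le_opNorm_of_le hvn)
  have hs1 : 0 < 1 - s := by
    have := toReal_inv_add_inv hpq
    have := one_div_pos.2 (q_pos q)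
    linarith
  have hlim : Tendsto (fun n : ℕ => (n : ℝ) ^ (1 - s)) atTop atTop :=
    (tendsto_rpow_atTop hs1).comp tendsto_natCast_atTop_atTop
  obtain ⟨n, hn1, hn⟩ := ((eventually_ge_atTop 1).and
    (hlim.eventually_gt_atTop (‖g‖ * (θ : ℝ)⁻¹ / δ))).exists
  have hn' : (0 : ℝ) < n := by exact_mod_cast hn1
  have hns : (0 : ℝ) < (n : ℝ) ^ s := Real.rpow_pos_of_pos hn' _
  rw [div_lt_iff₀ hδ, Real.rpow_sub hn', Real.rpow_one, div_mul_eq_mul_div, lt_div_iff₀ hns] at hn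
  linarith [hbound n]

end Tsirelson

/-! ### Uniform constants and the implication from $\mathsf A_p$ to $\mathsf N_p$ -/

section Constants

variable {𝕜 : Type u} [RCLike 𝕜] {p : ℝ≥0∞} {X : Type v} [NormedAddCommGroup X] [NormedSpace 𝕜 X]

lemma hasA_of_winsA {c : ℝ} (hc : 0 < c) (h : ∀ n, WinsA 𝕜 p X c n) : HasA 𝕜 p X :=
  (iSup_le fun n => iInf_le_of_le c (iInf_le_of_le hc (iInf_le_of_le (h n) le_rfl))).trans_lt
    (ENNReal.ofReal_lt_top (r := c))

lemma HasA.exists_winsA (h : HasA 𝕜 p X) : ∃ C : ℝ, 1 ≤ C ∧ ∀ n, WinsA 𝕜 p X C n := by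
  obtain ⟨B, hB, hBtop⟩ := exists_between h
  refine ⟨max 1 B.toReal, le_max_left _ _, fun n => ?_⟩
  have hn := (le_iSup (fun n => aConst 𝕜 p X n) n).trans_lt hB
  simp only [aConst, iInf_lt_iff] at hn
  obtain ⟨c, -, ⟨χ, hχ⟩, hcB⟩ := hn
  refine ⟨χ, fun x hx a ha => (hχ x hx a ha).trans (le_max_of_le_right ?_)⟩
  exact (ENNReal.ofReal_le_iff_le_toReal hBtop.ne).1 hcB.le

lemma HasN.exists_winsN (h : HasN 𝕜 p X) : ∃ C : ℝ, 1 ≤ C ∧ ∀ n, WinsN 𝕜 p X C n := by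
  obtain ⟨B, hB, hBtop⟩ := exists_between h
  refine ⟨max 1 B.toReal, le_max_left _ _, fun n => ?_⟩
  have hn := (le_iSup (fun n => nConst 𝕜 p X n) n).trans_lt hB
  simp only [nConst, iInf_lt_iff] at hn
  obtain ⟨c, -, ⟨χ, hχ⟩, hcB⟩ := hn
  refine ⟨χ, fun x hx => (hχ x hx).trans (mul_le_mul_of_nonneg_right (le_max_of_le_right ?_)
    (Real.rpow_nonneg (Nat.cast_nonneg _) _))⟩
  exact (ENNReal.ofReal_le_iff_le_toReal hBtop.ne).1 hcB.le

/-- The $N$ game tests the condition of the $A$ game on the single coefficient vector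
$n^{-1/p}(1,\dots,1)$. -/
lemma WinsA.winsN (hp : 1 < p) {c : ℝ} (hc : 0 ≤ c) {n : ℕ} (h : WinsA 𝕜 p X c n) :
    WinsN 𝕜 p X c n := by
  obtain ⟨χ, hχ⟩ := h
  refine ⟨χ, fun x hx => ?_⟩
  rcases Nat.eq_zero_or_pos n with rfl | hn
  · simp only [Finset.univ_eq_empty, Finset.sum_empty, norm_zero]
    positivity
  have hns : (0 : ℝ) < (n : ℝ) ^ (p⁻¹).toReal :=
    Real.rpow_pos_of_pos (by exact_mod_cast hn) _
  have h1 := hχ x hx _ (norm_flat_le_one (c := fun _ : Fin n => (1 : 𝕜)) hp fun i => by simp)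
  simp only [mul_one] at h1
  rw [← Finset.smul_sum, norm_smul, RCLike.norm_of_nonneg (inv_nonneg.2 hns.le),
    inv_mul_le_iff₀ hns] at h1
  linarith

lemma HasA.hasN (hp : 1 < p) (h : HasA 𝕜 p X) : HasN 𝕜 p X := by
  obtain ⟨C, hC, hA⟩ := h.exists_winsA
  have hC0 : 0 < C := one_pos.trans_le hC
  exact (iSup_le fun n => iInf_le_of_le C (iInf_le_of_le hC0
    (iInf_le_of_le ((hA n).winsN hp hC0.le) le_rfl))).trans_lt (ENNReal.ofReal_lt_top (r := C))

end Constants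

/-! ### Non-embeddability into quotients of spaces with $\mathsf N_p$ -/

namespace Tsirelson

variable {𝕜 : Type u} [RCLike 𝕜] {p : ℝ≥0∞} {q : Set.Ici (1 : ℝ)} {θ : Set.Ioo (0 : ℝ) 1}

lemma l1_single_one (k : ℕ) : l1 (Finsupp.single k 1) = 1 := by
  rw [l1_eq Finsupp.support_single_subset]
  simp

lemma powComb_single (s : ℝ) {Q : Type*} [AddCommGroup Q] [Module 𝕜 Q] (z : ℕ → Q) (k : ℕ) :
    powComb 𝕜 s z (Finsupp.single k 1) = z k := by
  rw [powComb, Finsupp.support_single k one_ne_zero]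
  simp

/-- The images of the coordinate functionals under a bounded operator into a quotient of `U` lift
to small multiples of themselves in the weak neighbourhoods of `0`. -/
lemma reach_coord (hp : 1 < p) (hpq : p.HolderConjugate (ENNReal.ofReal (q : ℝ)))
    {U : Type v} [NormedAddCommGroup U] [NormedSpace 𝕜 U] (N : Submodule 𝕜 U)
    (Φ : TsirelsonDual 𝕜 q θ →L[𝕜] U ⧸ N) :
    Reach N.mkQ (fun k => Φ (coord 𝕜 q θ k)) (p⁻¹).toReal ((4 * (‖Φ‖ + 1))⁻¹)
      fun _ x => tnorm ((θ : ℝ) ^ (q : ℝ)) x ≤ 1 := by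
  intro K F η hη
  have hA : 0 < ‖Φ‖ + 1 := by positivity
  -- Dividing by $\|\Phi\|+1$ puts the images in the unit ball without excluding $\Phi=0$; the
  -- further factor $1/4$ compensates for the norm of the lifting.
  obtain ⟨j, hj, y, hy, hy4, hyF⟩ := exists_lift_small N
    (y := fun k => (((‖Φ‖ + 1)⁻¹ : ℝ) : 𝕜) • Φ (coord 𝕜 q θ k)) (fun k => by
      rw [norm_smul, RCLike.norm_of_nonneg (inv_nonneg.2 hA.le), inv_mul_le_iff₀ hA, mul_one]
      have := Φ.le_opNorm_of_le (norm_coord_le (𝕜 := 𝕜) (q := q) (θ := θ) k)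
      linarith) (fun g => by
      have := (tendsto_apply_coord hp hpq (g.comp Φ)).const_mul (((‖Φ‖ + 1)⁻¹ : ℝ) : 𝕜)
      simpa using this) F hη K
  have h4 : ‖(((4 : ℝ)⁻¹ : ℝ) : 𝕜)‖ = 4⁻¹ := RCLike.norm_of_nonneg (by norm_num)
  refine ⟨(((4 : ℝ)⁻¹ : ℝ) : 𝕜) • y, Finsupp.single j 1, ⟨?_, fun f hf => ?_, ?_⟩, fun k => ?_,
    l1_single_one j, fun k hk => ?_, ?_⟩
  · rw [norm_smul, h4]
    linarith
  · rw [map_smul, norm_smul, h4]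
    linarith [hyF f hf, norm_nonneg (f y)]
  · rw [map_smul, hy, powComb_single, smul_smul, ← RCLike.ofReal_mul, ← mul_inv]
  · rw [Finsupp.single_apply]
    split_ifs <;> norm_num
  · rw [Finset.mem_singleton.1 (Finsupp.support_single_subset hk)]
    exact hj
  · exact (tnorm_le_l1 (par_nonneg q θ) (par_le_one q θ) _).trans (l1_single_one j).le

/-- Convex weights with small Tsirelson norm give large vectors in the dual. -/
lemma one_le_norm_powComb_mul (hpq : p.HolderConjugate (ENNReal.ofReal (q : ℝ))) {x : ℕ →₀ ℝ}
    (h0 : ∀ k, 0 ≤ x k) (hl : l1 x = 1) :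
    1 ≤ ‖powComb 𝕜 (p⁻¹).toReal (coord 𝕜 q θ) x‖ *
      tnorm ((θ : ℝ) ^ (q : ℝ)) x ^ (1 / (q : ℝ)) := by
  have hq := q_pos q
  -- The test vector $w=x^{1/q}$ satisfies $|w|^q=x$ and pairs with $x^{1/p}$ to $\sum_kx_k=1$,
  -- because $1/p+1/q=1$.
  set w : ℕ →₀ 𝕜 := x.mapRange (fun a => ((a ^ (1 / (q : ℝ)) : ℝ) : 𝕜))
    (by simp [Real.zero_rpow (inv_ne_zero hq.ne')]) with hw
  have hwk : ∀ k, w k = ((x k ^ (1 / (q : ℝ)) : ℝ) : 𝕜) := fun k => Finsupp.mapRange_apply ..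
  have hwn : qnorm q θ w = tnorm ((θ : ℝ) ^ (q : ℝ)) x ^ (1 / (q : ℝ)) := by
    have : absPow q w = x := by
      ext k
      rw [absPow_apply, hwk, RCLike.norm_of_nonneg (Real.rpow_nonneg (h0 k) _),
        ← Real.rpow_mul (h0 k), one_div_mul_cancel hq.ne', Real.rpow_one]
    rw [qnorm, this]
  have hpair : powComb 𝕜 (p⁻¹).toReal (coord 𝕜 q θ) x (emb 𝕜 q θ w) = 1 := by
    rw [powComb, _root_.sum_apply]
    have : ∀ k ∈ x.support, ((((x k ^ (p⁻¹).toReal : ℝ) : 𝕜) • coord 𝕜 q θ k) (emb 𝕜 q θ w)) =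
        ((|x k| : ℝ) : 𝕜) := by
      intro k hk
      have hk0 : 0 < x k := (h0 k).lt_of_ne' (Finsupp.mem_support_iff.1 hk)
      rw [_root_.smul_apply, coord_emb, hwk, smul_eq_mul, ← RCLike.ofReal_mul, ← Real.rpow_add hk0,
        toReal_inv_add_inv hpq, Real.rpow_one, abs_of_pos hk0]
    rw [Finset.sum_congr rfl this, ← RCLike.ofReal_sum]
    change ((l1 x : ℝ) : 𝕜) = 1
    rw [hl, RCLike.ofReal_one]
  rw [← hwn]
  refine le_trans ?_ (norm_dual_apply_le _ w)
  rw [hpair, norm_one]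

lemma powComb_map {Q R : Type*} [AddCommGroup Q] [Module 𝕜 Q] [AddCommGroup R] [Module 𝕜 R]
    (T : Q →ₗ[𝕜] R) (s : ℝ) (z : ℕ → Q) (x : ℕ →₀ ℝ) :
    powComb 𝕜 s (fun k => T (z k)) x = T (powComb 𝕜 s z x) := by
  simp only [powComb, map_sum, map_smul]

lemma exists_not_isoToSubspaceOfQuotient (hp : 1 < p)
    (hpq : p.HolderConjugate (ENNReal.ofReal (q : ℝ)))
    {U : Type v} [NormedAddCommGroup U] [NormedSpace 𝕜 U] (hU : HasN 𝕜 p U) :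
    ∃ θ : Set.Ioo (0 : ℝ) 1, ¬ IsoToSubspaceOfQuotient 𝕜 (TsirelsonDual 𝕜 q θ) U := by
  obtain ⟨C, hC, hN⟩ := hU.exists_winsN
  have hC0 : 0 < C := one_pos.trans_le hC
  have hC2 : 1 ≤ C * C := one_le_mul_of_one_le_of_one_le hC hC
  -- Here $2t=\tfrac12C^{-2}$: a double average loses $C^2$ in $U$, whereas the lower bound for the
  -- norm in the dual grows by $2C^2$.
  set t : ℝ := (4 * (C * C))⁻¹ with ht
  have ht0 : 0 < t := by positivity
  have ht1 : t < 1 := inv_lt_one_of_one_lt₀ (by linarith)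
  set θ : Set.Ioo (0 : ℝ) 1 := ⟨t, ht0, ht1⟩ with hθ
  refine ⟨θ, ?_⟩
  rintro ⟨M, -, Y, -, ⟨e⟩⟩
  set Φ : TsirelsonDual 𝕜 q θ →L[𝕜] U ⧸ M :=
    Y.subtypeL.comp (e : TsirelsonDual 𝕜 q θ →L[𝕜] Y) with hΦ
  obtain ⟨B, hB0, hlow⟩ : ∃ B : ℝ, 0 ≤ B ∧ ∀ f, ‖f‖ ≤ B * ‖Φ f‖ := by
    refine ⟨‖(e.symm : Y →L[𝕜] TsirelsonDual 𝕜 q θ)‖,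
      ContinuousLinearMap.opNorm_nonneg _, fun f => ?_⟩
    have h := (e.symm : Y →L[𝕜] TsirelsonDual 𝕜 q θ).le_opNorm (e f)
    have he : (e.symm : Y →L[𝕜] TsirelsonDual 𝕜 q θ) (e f) = f := e.symm_apply_apply f
    rwa [he] at h
  set c₀ : ℝ := (4 * (‖Φ‖ + 1))⁻¹ with hc₀
  have hc0 : 0 < c₀ := by positivity
  have key : ∀ j : ℕ, c₀ ≤ B * (1 / 2) ^ j := by
    intro j
    -- Position and weak smallness mattered only during the iteration, so trivial data suffice for
    -- the final vector.
    obtain ⟨y, x, ⟨hy1, -, hy⟩, hx0, hxl, -, hxt⟩ :=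
      (reach_coord hp hpq M Φ).tnorm_iterate hC hN (par_pos q θ) (par_le_one q θ) j 0 ∅ 1 one_pos
    set f := powComb 𝕜 (p⁻¹).toReal (coord 𝕜 q θ) x with hf
    have hmap : powComb 𝕜 (p⁻¹).toReal (fun k => Φ (coord 𝕜 q θ k)) x = Φ f :=
      powComb_map (Φ : TsirelsonDual 𝕜 q θ →ₗ[𝕜] U ⧸ M) _ _ _
    have hcj : 0 < (C⁻¹ * C⁻¹) ^ j * c₀ := by positivity
    have hΦf : (C⁻¹ * C⁻¹) ^ j * c₀ * ‖Φ f‖ ≤ 1 := by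
      have h1 : ‖M.mkQ y‖ ≤ 1 := (Submodule.Quotient.norm_mk_le M y).trans hy1
      rwa [hy, hmap, norm_smul, RCLike.norm_of_nonneg hcj.le] at h1
    have hw : tnorm ((θ : ℝ) ^ (q : ℝ)) x ^ (1 / (q : ℝ)) ≤ (2 * t) ^ j := by
      have hq := q_pos q
      -- Since $q\ge1$, $2\le2^q$; the factor $2$ in $2\tau$ thus remains at most $2$ after the
      -- $q$-th root.
      have h2 : 2 * (θ : ℝ) ^ (q : ℝ) ≤ (2 * t) ^ (q : ℝ) := by
        rw [Real.mul_rpow two_pos.le ht0.le]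
        exact mul_le_mul_of_nonneg_right (Real.self_le_rpow_of_one_le one_le_two q.2)
          (par_nonneg q θ)
      have h3 : tnorm ((θ : ℝ) ^ (q : ℝ)) x ≤ ((2 * t) ^ j) ^ (q : ℝ) := by
        refine hxt.trans ?_
        rw [← Real.rpow_natCast (2 * t) j, ← Real.rpow_mul (by positivity), mul_comm (j : ℝ),
          Real.rpow_mul (by positivity), Real.rpow_natCast]
        exact pow_le_pow_left₀ (mul_nonneg two_pos.le (par_nonneg q θ)) h2 j
      calc tnorm ((θ : ℝ) ^ (q : ℝ)) x ^ (1 / (q : ℝ))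
          ≤ (((2 * t) ^ j) ^ (q : ℝ)) ^ (1 / (q : ℝ)) :=
            Real.rpow_le_rpow (tnorm_nonneg _ _) h3 (one_div_nonneg.2 hq.le)
        _ = (2 * t) ^ j := by
            rw [← Real.rpow_mul (by positivity), mul_one_div_cancel hq.ne', Real.rpow_one]
    have h1 : 1 ≤ ‖f‖ * (2 * t) ^ j :=
      (one_le_norm_powComb_mul hpq hx0 hxl).trans
        (mul_le_mul_of_nonneg_left hw (norm_nonneg _))
    have hid : (C⁻¹ * C⁻¹) ^ j * (1 / 2) ^ j = (2 * t) ^ j := by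
      rw [← mul_pow, ht]
      congr 1
      field_simp
      norm_num
    have hCj : 0 < (C⁻¹ * C⁻¹) ^ j := by positivity
    refine le_of_mul_le_mul_left ?_ hCj
    calc (C⁻¹ * C⁻¹) ^ j * c₀ ≤ (C⁻¹ * C⁻¹) ^ j * c₀ * (‖f‖ * (2 * t) ^ j) :=
          le_mul_of_one_le_right hcj.le h1
      _ ≤ (C⁻¹ * C⁻¹) ^ j * c₀ * (B * ‖Φ f‖ * (2 * t) ^ j) := by
          gcongr
          exact hlow f
      _ = (C⁻¹ * C⁻¹) ^ j * c₀ * ‖Φ f‖ * (B * (2 * t) ^ j) := by ring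
      _ ≤ 1 * (B * (2 * t) ^ j) := by gcongr
      _ = (C⁻¹ * C⁻¹) ^ j * (B * (1 / 2) ^ j) := by
          rw [← hid]
          ring
  have hlim : Filter.Tendsto (fun j : ℕ => B * (1 / 2 : ℝ) ^ j) Filter.atTop (nhds (B * 0)) :=
    (tendsto_pow_atTop_nhds_zero_of_lt_one (by norm_num) (by norm_num)).const_mul B
  have := ge_of_tendsto' hlim key
  linarith

end Tsirelson

theorem theoremC {𝕜 : Type u} [RCLike 𝕜] (p : ℝ≥0∞) (hp : 1 < p)
    (q : Set.Ici (1 : ℝ)) (hpq : p.HolderConjugate (ENNReal.ofReal (q : ℝ))) :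
    -- every `T_{q,θ}^*` is a separable infinite-dimensional space with `A_p`
    (∀ θ : Set.Ioo (0 : ℝ) 1,
      HasA 𝕜 p (TsirelsonDual 𝕜 q θ) ∧
      TopologicalSpace.SeparableSpace (TsirelsonDual 𝕜 q θ) ∧
      ¬ FiniteDimensional 𝕜 (TsirelsonDual 𝕜 q θ)) ∧
    -- no space with `N_p` contains all of them as subspaces of quotients
    (∀ (U : Type v) [NormedAddCommGroup U] [NormedSpace 𝕜 U] [CompleteSpace U],
      HasN 𝕜 p U →
        ∃ θ : Set.Ioo (0 : ℝ) 1, ¬ IsoToSubspaceOfQuotient 𝕜 (TsirelsonDual 𝕜 q θ) U) ∧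
    -- `A_p` has no universal space
    (∀ (U : Type v) [NormedAddCommGroup U] [NormedSpace 𝕜 U] [CompleteSpace U],
      HasA 𝕜 p U →
        ¬ ∀ (X : Type u) [NormedAddCommGroup X] [NormedSpace 𝕜 X] [CompleteSpace X],
          TopologicalSpace.SeparableSpace X → ¬ FiniteDimensional 𝕜 X → HasA 𝕜 p X →
            IsoToSubspaceOfQuotient 𝕜 X U) ∧
    -- `N_p` has no universal space
    (∀ (U : Type v) [NormedAddCommGroup U] [NormedSpace 𝕜 U] [CompleteSpace U],
      HasN 𝕜 p U →
        ¬ ∀ (X : Type u) [NormedAddCommGroup X] [NormedSpace 𝕜 X] [CompleteSpace X],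
          TopologicalSpace.SeparableSpace X → ¬ FiniteDimensional 𝕜 X → HasN 𝕜 p X →
            IsoToSubspaceOfQuotient 𝕜 X U) := by
  have h1 : ∀ θ : Set.Ioo (0 : ℝ) 1, HasA 𝕜 p (TsirelsonDual 𝕜 q θ) := fun θ =>
    hasA_of_winsA (add_pos (inv_pos.2 θ.2.1) one_pos) (Tsirelson.winsA hp hpq)
  refine ⟨fun θ => ⟨h1 θ, Tsirelson.separableSpace_dual, Tsirelson.not_finiteDimensional_dual⟩,
    fun U _ _ _ hU => Tsirelson.exists_not_isoToSubspaceOfQuotient hp hpq hU,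
    fun U _ _ _ hU h => ?_, fun U _ _ _ hU h => ?_⟩
  · obtain ⟨θ, hθ⟩ := Tsirelson.exists_not_isoToSubspaceOfQuotient hp hpq (hU.hasN hp)
    exact hθ (h _ Tsirelson.separableSpace_dual Tsirelson.not_finiteDimensional_dual (h1 θ))
  · obtain ⟨θ, hθ⟩ := Tsirelson.exists_not_isoToSubspaceOfQuotient hp hpq hU
    exact hθ (h _ Tsirelson.separableSpace_dual Tsirelson.not_finiteDimensional_dual
      ((h1 θ).hasN hp))
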